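/- **Theorem 2.4 (vector-valued Gaussian Poincaré inequality).** Let $\mathcal H$ and $\mathcal V$ be real separable Hilbert spaces, let $(\Omega,\mathcal F,\mathbb P)$ be a probability space, and let $W=\{W(h)\}_{h\in\mathcal H}$ be an isonormal Gaussian process over $\mathcal H$ defined on it, i.e. a centered Gaussian family of real random variables with $\mathbb E[W(h)W(g)]=\langle h,g\rangle_{\mathcal H}$ for all $h,g\in\mathcal H$. A random variable $F:\Omega\to\mathcal V$ is called *smooth*, written $F\in\mathcal S_{\mathcal V}$, if almost surely $$F=\sum_{j=1}^J F_j\,v_j ,\qquad F_j=f_j\big(W(h_{j,1}),\dots,W(h_{j,m_j})\big),$$ for some $J,m_j\ge 1$, $v_j\in\mathcal V$, $h_{j,i}\in\mathcal H$ and functions $f_j\in C^\infty(\mathbb R^{m_j})$ which, together with all their partial derivatives, have at most polynomial growth. Its Malliavin derivative is the random variable $$DF=\sum_{j=1}^J\Big(\sum_{i=1}^{m_j}\frac{\partial f_j}{\partial x_i}\big(W(h_{j,1}),\dots,W(h_{j,m_j})\big)\,h_{j,i}\Big)\otimes v_j$$ with values in the Hilbert tensor product $\mathcal H\otimes\mathcal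 V$. For a Hilbert space $K$ and a $K$-valued random variable $X$ write $\|X\|_{L^q(\Omega;K)}=(\mathbb E[\|X\|_K^q])^{1/q}$. Then for every $q\in[1,\infty)$ and every $F\in\mathcal S_{\mathcal V}$ we have $F\in L^q(\Omega;\mathcal V)$, $DF\in L^q(\Omega;\mathcal H\otimes\mathcal V)$ and $$\big\|F-\mathbb E[F]\big\|_{L^q(\Omega;\mathcal V)}\le c_q\,\|DF\|_{L^q(\Omega;\mathcal H\otimes\mathcal V)},\qquad c_q=\begin{cases}\sqrt{q-1}&\text{if } q\in[2,\infty),\\ \pi/2&\text{if } q\in[1,2).\end{cases}$$ -/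

import Mathlib

open MeasureTheory ProbabilityTheory
open scoped TensorProduct

namespace Malliavin

/-- An isonormal Gaussian process over the real inner product space `H`: a centered Gaussian
family `(W h)_{h ∈ H}` of real random variables with covariance `𝔼[W h * W g] = ⟪h, g⟫`. -/
structure IsIsonormal {Ω H : Type*} [MeasurableSpace Ω] [NormedAddCommGroup H]
    [InnerProductSpace ℝ H] (W : H → Ω → ℝ) (P : Measure Ω) : Prop where
  isGaussianProcess : IsGaussianProcess W P
  centered : ∀ h : H, ∫ ω, W h ω ∂P = 0
  covariance : ∀ h g : H, ∫ ω, W h ω * W g ω ∂P = inner ℝ h g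

/-- The Hilbert tensor product `H ⊗ V`: the completion of the algebraic tensor product with
respect to the inner product determined by `⟪a ⊗ v, b ⊗ w⟫ = ⟪a, b⟫ * ⟪v, w⟫`. -/
abbrev HilbertTensor (H V : Type*) [NormedAddCommGroup H] [InnerProductSpace ℝ H]
    [NormedAddCommGroup V] [InnerProductSpace ℝ V] : Type _ :=
  UniformSpace.Completion (H ⊗[ℝ] V)

/-- `F = f (W h₁, …, W hₘ)` almost surely, where `f` is `C^∞` and all its derivatives (of every
order, including zero) have at most polynomial growth, and
`DF = ∑ᵢ (∂f / ∂xᵢ) (W h₁, …, W hₘ) hᵢ` almost surely. -/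
def HasScalarDeriv {Ω H : Type*} [MeasurableSpace Ω] [NormedAddCommGroup H]
    [InnerProductSpace ℝ H] (W : H → Ω → ℝ) (P : Measure Ω) (F : Ω → ℝ) (DF : Ω → H) : Prop :=
  ∃ (m : ℕ) (h : Fin m → H) (f : (Fin m → ℝ) → ℝ),
    1 ≤ m ∧ f.HasTemperateGrowth ∧
    (∀ᵐ ω ∂P, F ω = f (fun i => W (h i) ω)) ∧
    (∀ᵐ ω ∂P, DF ω = ∑ i, fderiv ℝ f (fun k => W (h k) ω) (Pi.single i 1) • h i)

/-- `F` is a smooth `V`-valued random variable, `F = ∑ⱼ Fⱼ vⱼ` with `Fⱼ` smooth real random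
variables and `vⱼ ∈ V`, and `DF = ∑ⱼ (D Fⱼ) ⊗ vⱼ` is its Malliavin derivative (both almost
surely). The Malliavin derivative is treated as a relation, so that a statement about all pairs
`(F, DF)` concerns every representation of `F`. -/
def HasDeriv {Ω H V : Type*} [MeasurableSpace Ω] [NormedAddCommGroup H]
    [InnerProductSpace ℝ H] [NormedAddCommGroup V] [InnerProductSpace ℝ V]
    (W : H → Ω → ℝ) (P : Measure Ω) (F : Ω → V) (DF : Ω → HilbertTensor H V) : Prop :=
  ∃ (J : ℕ) (G : Fin J → Ω → ℝ) (DG : Fin J → Ω → H) (v : Fin J → V),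
    1 ≤ J ∧ (∀ j, HasScalarDeriv W P (G j) (DG j)) ∧
    (∀ᵐ ω ∂P, F ω = ∑ j, G j ω • v j) ∧
    (∀ᵐ ω ∂P, DF ω = ∑ j, ((DG j ω ⊗ₜ[ℝ] v j : H ⊗[ℝ] V) : HilbertTensor H V))

/-- The constant `√(q - 1)` for `q ≥ 2` and `π / 2` for `q < 2`. -/
noncomputable def poincareConst (q : ℝ) : ℝ :=
  if 2 ≤ q then Real.sqrt (q - 1) else Real.pi / 2

end Malliavin

/-!
A smooth random variable is `F = Φ(ξ)`, where `ξ` collects the coordinates of the isonormal process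
along an orthonormal basis `e` of the finite-dimensional span of the vectors `h_{j,i}`, and
`Φ : ℝⁿ → V` is smooth of temperate growth. The vector `ξ` is standard Gaussian, and
`DF = ∑ₖ eₖ ⊗ ∂ₖΦ(ξ)` has as its norm the Hilbert–Schmidt norm of the derivative of `Φ` at `ξ`
(`HasDeriv.exists_orthonormal`, `IsIsonormal.map_eq_gaussianPi`, `norm_toHilbertTensor`). This
leaves an inequality for the standard Gaussian measure `γ` on `ℝⁿ`.

Let `x, y` be independent with law `γ`, and put `u = cos θ x + sin θ y` and
`w = -sin θ x + cos θ y`. For every `θ` the pair `(u, w)` has the law of `(x, y)`, and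
`Φ y - Φ x = ∫ DΦ(u) w dθ` over `[0, π / 2]` (`sub_eq_integral_rotation`).

* For `1 ≤ q ≤ 2`, Jensen's inequality bounds `𝔼 ‖Φ - 𝔼 Φ‖ ^ q` by `𝔼 ‖Φ y - Φ x‖ ^ q`, and then by
  `(π / 2) ^ q 𝔼 ‖DΦ(x) y‖ ^ q`. For fixed `x` the Gaussian vector `DΦ(x) y` has second moment
  `‖DΦ(x)‖²` in Hilbert–Schmidt norm, so its `q`-th moment is at most `‖DΦ(x)‖ ^ q`
  (`lintegral_enorm_sub_integral_rpow_le`).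

* For `q ≥ 2` and `𝔼 Φ = 0`, take the inner product of the formula with `G y`, where
  `G = ‖Φ‖ ^ (q - 2) Φ`. Its expectation is `𝔼 ‖Φ‖ ^ q`. Since `y = sin θ u + cos θ w`, Gaussian
  integration by parts in `w` turns `𝔼 ⟪DΦ(u) w, G y⟫` into `cos θ 𝔼 ⟪DΦ(u), DG(y)⟫`, which
  is at most `(q - 1) cos θ 𝔼 [‖DΦ(u)‖ ‖DΦ(y)‖ ‖Φ(y)‖ ^ (q - 2)]`, because the derivative of
  `v ↦ ‖v‖ ^ (q - 2) v` has norm at most `(q - 1) ‖v‖ ^ (q - 2)`. As `u` and `y` both have law `γ`,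
  Hölder's inequality and `∫ cos θ dθ = 1` give
  `𝔼 ‖Φ‖ ^ q ≤ (q - 1) (𝔼 ‖DΦ‖ ^ q) ^ (2 / q) (𝔼 ‖Φ‖ ^ q) ^ (1 - 2 / q)`
  (`integral_norm_rpow_le_of_integral_eq_zero`), which is the claim.
-/

namespace Malliavin

/-! ### Polynomial growth and moments -/

section Growth

variable {E E' F F' : Type*} [NormedAddCommGroup E] [NormedAddCommGroup E']
  [NormedAddCommGroup F] [NormedAddCommGroup F']

/-- `g` has at most polynomial growth. -/
def PolyGrowth (g : E → F) : Prop := ∃ (C : ℝ) (k : ℕ), ∀ x, ‖g x‖ ≤ C * (1 + ‖x‖) ^ k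

/-- `μ` has finite moments of all orders. The integrands are powers of `1 + ‖x‖`, so that `μ` is in
particular finite. -/
def HasMoments [MeasurableSpace E] (μ : Measure E) : Prop :=
  ∀ k : ℕ, Integrable (fun x => (1 + ‖x‖) ^ k) μ

lemma PolyGrowth.exists_nonneg {g : E → F} (hg : PolyGrowth g) :
    ∃ (C : ℝ) (k : ℕ), 0 ≤ C ∧ ∀ x, ‖g x‖ ≤ C * (1 + ‖x‖) ^ k := by
  obtain ⟨C, k, h⟩ := hg
  refine ⟨|C|, k, abs_nonneg _, fun x => (h x).trans ?_⟩
  gcongr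
  exact le_abs_self C

lemma PolyGrowth.of_le {g : E → F} {f : E → F'} (hg : PolyGrowth g) (h : ∀ x, ‖f x‖ ≤ ‖g x‖) :
    PolyGrowth f := by
  obtain ⟨C, k, hC⟩ := hg
  exact ⟨C, k, fun x => (h x).trans (hC x)⟩

lemma polyGrowth_const (c : F) : PolyGrowth (fun _ : E => c) := ⟨‖c‖, 0, fun x => by simp⟩

lemma PolyGrowth.of_le_mul {g : E → F} {g' : E → F'} {f : E → E'} (hg : PolyGrowth g)
    (hg' : PolyGrowth g') (h : ∀ x, ‖f x‖ ≤ ‖g x‖ * ‖g' x‖) : PolyGrowth f := by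
  obtain ⟨C, k, hC0, hC⟩ := hg.exists_nonneg
  obtain ⟨D, l, hD0, hD⟩ := hg'.exists_nonneg
  refine ⟨C * D, k + l, fun x => (h x).trans ?_⟩
  calc ‖g x‖ * ‖g' x‖ ≤ (C * (1 + ‖x‖) ^ k) * (D * (1 + ‖x‖) ^ l) := by
        gcongr
        · exact hC x
        · exact hD x
    _ = _ := by ring

lemma PolyGrowth.of_norm_le {g : E → F} {f : E → F'} (hg : PolyGrowth g) (c : ℝ)
    (h : ∀ x, ‖f x‖ ≤ c * ‖g x‖) : PolyGrowth f := by
  refine (polyGrowth_const (E := E) c).of_le_mul hg fun x => (h x).trans ?_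
  gcongr
  exact Real.le_norm_self c

lemma polyGrowth_id : PolyGrowth (fun x : E => x) := ⟨1, 1, fun x => by simp⟩

lemma PolyGrowth.add {f g : E → F} (hf : PolyGrowth f) (hg : PolyGrowth g) :
    PolyGrowth (fun x => f x + g x) := by
  obtain ⟨C, k, hC0, hC⟩ := hf.exists_nonneg
  obtain ⟨D, l, hD0, hD⟩ := hg.exists_nonneg
  refine ⟨C + D, k + l, fun x => (norm_add_le _ _).trans ?_⟩
  have h1 : (1 : ℝ) ≤ 1 + ‖x‖ := by simp
  calc ‖f x‖ + ‖g x‖ ≤ C * (1 + ‖x‖) ^ k + D * (1 + ‖x‖) ^ l := add_le_add (hC x) (hD x)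
    _ ≤ C * (1 + ‖x‖) ^ (k + l) + D * (1 + ‖x‖) ^ (k + l) := by
        gcongr <;> first | exact h1 | omega
    _ = _ := by ring

lemma PolyGrowth.sub {f g : E → F} (hf : PolyGrowth f) (hg : PolyGrowth g) :
    PolyGrowth (fun x => f x - g x) := by
  simpa [sub_eq_add_neg] using hf.add (hg.of_le (f := fun x => -g x) (by simp))

lemma PolyGrowth.mul {f g : E → ℝ} (hf : PolyGrowth f) (hg : PolyGrowth g) :
    PolyGrowth (fun x => f x * g x) := hf.of_le_mul hg fun _ => (norm_mul _ _).le

lemma PolyGrowth.pow {f : E → ℝ} (hf : PolyGrowth f) (n : ℕ) :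
    PolyGrowth (fun x => f x ^ n) := by
  induction n with
  | zero => simpa using polyGrowth_const (1 : ℝ)
  | succ n ih => simpa only [pow_succ] using ih.mul hf

lemma PolyGrowth.norm {f : E → F} (hf : PolyGrowth f) : PolyGrowth (fun x => ‖f x‖) :=
  hf.of_le (by simp)

lemma PolyGrowth.norm_rpow {f : E → F} (hf : PolyGrowth f) {r : ℝ} (hr : 0 ≤ r) :
    PolyGrowth (fun x => ‖f x‖ ^ r) := by
  refine (((polyGrowth_const (1 : ℝ)).add hf.norm).pow ⌈r⌉₊).of_le fun x => ?_
  have h1 : (1 : ℝ) ≤ 1 + ‖f x‖ := by simp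
  rw [Real.norm_of_nonneg (by positivity), Real.norm_of_nonneg (by positivity)]
  calc ‖f x‖ ^ r ≤ (1 + ‖f x‖) ^ r := by gcongr; simp
    _ ≤ (1 + ‖f x‖) ^ ((⌈r⌉₊ : ℕ) : ℝ) := Real.rpow_le_rpow_of_exponent_le h1 (Nat.le_ceil r)
    _ = _ := Real.rpow_natCast _ _

lemma PolyGrowth.comp {g : E → F} {f : E' → E} (hg : PolyGrowth g) (hf : PolyGrowth f) :
    PolyGrowth (fun x => g (f x)) := by
  obtain ⟨C, k, hC⟩ := hg
  refine PolyGrowth.of_norm_le (((polyGrowth_const (1 : ℝ)).add hf.norm).pow k) C fun x => ?_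
  rw [Real.norm_of_nonneg (by positivity)]
  exact hC (f x)

lemma HasMoments.integrable [MeasurableSpace E] {μ : Measure E} (hμ : HasMoments μ) {g : E → F}
    (hg : PolyGrowth g) (hm : AEStronglyMeasurable g μ) : Integrable g μ := by
  obtain ⟨C, k, hC⟩ := hg
  exact ((hμ k).const_mul C).mono' hm (ae_of_all _ hC)

lemma HasMoments.memLp [MeasurableSpace E] {μ : Measure E} (hμ : HasMoments μ) {g : E → F}
    (hg : PolyGrowth g) (hm : AEStronglyMeasurable g μ) {p : ℝ} (hp : 0 < p) :
    MemLp g (ENNReal.ofReal p) μ := by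
  rw [← integrable_norm_rpow_iff hm (by simpa) (by simp)]
  rw [ENNReal.toReal_ofReal hp.le]
  exact hμ.integrable (hg.norm_rpow hp.le) (hm.norm.aemeasurable.pow_const p).aestronglyMeasurable

lemma HasMoments.prod [MeasurableSpace E] [MeasurableSpace E'] [OpensMeasurableSpace E]
    [OpensMeasurableSpace E'] [SecondCountableTopology E] [SecondCountableTopology E']
    {μ : Measure E} {ν : Measure E'} [SFinite μ] [SFinite ν] (hμ : HasMoments μ)
    (hν : HasMoments ν) : HasMoments (μ.prod ν) := by
  intro k
  refine ((hμ k).mul_prod (hν k)).mono' (by fun_prop) (ae_of_all _ fun z => ?_)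
  rw [Real.norm_of_nonneg (by positivity), ← mul_pow]
  gcongr
  have : ‖z‖ ≤ ‖z.1‖ + ‖z.2‖ := by
    rw [Prod.norm_def]; exact max_le_add_of_nonneg (norm_nonneg _) (norm_nonneg _)
  nlinarith [norm_nonneg z.1, norm_nonneg z.2]

lemma hasMoments_restrict_Ioc (a b : ℝ) : HasMoments (volume.restrict (Set.Ioc a b)) := by
  intro k
  exact (Continuous.integrableOn_Ioc (by fun_prop))

lemma hasMoments_of_isGaussian [NormedSpace ℝ E] [MeasurableSpace E] [BorelSpace E]
    [CompleteSpace E] [SecondCountableTopology E] (μ : Measure E) [IsGaussian μ] :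
    HasMoments μ := by
  intro k
  rcases eq_or_ne k 0 with rfl | hk
  · simp
  have h1 : MemLp (fun x : E => ‖x‖) k μ := by
    have := IsGaussian.memLp_id μ (k : ENNReal) (ENNReal.natCast_ne_top k)
    exact this.norm
  have h2 : MemLp (fun _ : E => (1 : ℝ)) k μ := memLp_const 1
  have h : MemLp (fun x : E => 1 + ‖x‖) k μ := h2.add h1
  refine (h.integrable_norm_pow hk).congr (ae_of_all _ fun x => ?_)
  simp only
  rw [Real.norm_of_nonneg (by positivity)]

end Growth

/-! ### The standard Gaussian measure on `ℝⁿ` and Gaussian integration by parts -/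

/-- The standard Gaussian measure on `Fin n → ℝ`, as a product measure. -/
noncomputable abbrev gaussianPi (n : ℕ) : Measure (Fin n → ℝ) :=
  Measure.pi fun _ => gaussianReal 0 1

instance isGaussian_gaussianPi (n : ℕ) : IsGaussian (gaussianPi n) := by
  have h : gaussianPi n = (stdGaussian (EuclideanSpace ℝ (Fin n))).map
      (PiLp.continuousLinearEquiv 2 ℝ fun _ : Fin n => ℝ) := by
    rw [← map_pi_eq_stdGaussian, Measure.map_map (by fun_prop) (by fun_prop)]
    exact Measure.map_id.symm
  rw [h]
  infer_instance

lemma integral_id_gaussianPi (n : ℕ) : (gaussianPi n)[id] = 0 := by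
  have hi : Integrable id (gaussianPi n) := IsGaussian.integrable_id
  ext i
  have := (ContinuousLinearMap.proj (R := ℝ) (φ := fun _ : Fin n => ℝ) i).integral_comp_comm hi
  simp only [ContinuousLinearMap.proj_apply, id] at this ⊢
  rw [← this]
  have h2 := integral_comp_eval (μ := fun _ : Fin n => gaussianReal 0 1) (i := i)
    (f := fun x : ℝ => x) (by fun_prop)
  simpa using h2

lemma integral_eval_mul_eval_gaussianPi (n : ℕ) (i j : Fin n) :
    ∫ x, x i * x j ∂(gaussianPi n) = if i = j then 1 else 0 := by
  split_ifs with h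
  · subst h
    have h2 := integral_comp_eval (μ := fun _ : Fin n => gaussianReal 0 1) (i := i)
      (f := fun x : ℝ => x * x) (by fun_prop)
    rw [h2]
    have := variance_id_gaussianReal (μ := 0) (v := 1)
    rw [variance_eq_integral (by fun_prop)] at this
    simpa [pow_two] using this
  · have hind : iIndepFun (fun (k : Fin n) (x : Fin n → ℝ) => x k) (gaussianPi n) :=
      iIndepFun_pi (X := fun _ t => t) (fun _ => by fun_prop)
    have := (hind.indepFun h).integral_mul_eq_mul_integral
      (measurable_pi_apply i).aestronglyMeasurable (measurable_pi_apply j).aestronglyMeasurable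
    simp only [Pi.mul_apply] at this
    rw [this]
    have h2 := integral_comp_eval (μ := fun _ : Fin n => gaussianReal 0 1) (i := i)
      (f := fun x : ℝ => x) (by fun_prop)
    rw [h2]
    simp

lemma hasDerivAt_gaussianPDFReal (x : ℝ) :
    HasDerivAt (gaussianPDFReal 0 1) (-x * gaussianPDFReal 0 1 x) x := by
  have h : HasDerivAt (fun x : ℝ => -(x - 0) ^ 2 / (2 * ((1 : NNReal) : ℝ))) (-x) x := by
    have := (((hasDerivAt_id x).sub_const 0).pow 2).neg.div_const (2 * ((1 : NNReal) : ℝ))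
    refine this.congr_deriv ?_
    simp
    ring
  refine (h.exp.const_mul ((√(2 * Real.pi * ((1 : NNReal) : ℝ)))⁻¹)).congr_deriv ?_
  rw [gaussianPDFReal]
  ring

lemma integrable_gaussianReal_iff {f : ℝ → ℝ} :
    Integrable f (gaussianReal 0 1) ↔ Integrable (fun x => gaussianPDFReal 0 1 x * f x) := by
  rw [gaussianReal_of_var_ne_zero _ one_ne_zero,
    integrable_withDensity_iff_integrable_smul' (measurable_gaussianPDF 0 1)
      (ae_of_all _ fun x => gaussianPDF_lt_top)]
  simp only [toReal_gaussianPDF, smul_eq_mul]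

/-- One-dimensional Gaussian integration by parts. -/
lemma integral_mul_gaussianReal {g g' : ℝ → ℝ} (hg : ∀ x, HasDerivAt g (g' x) x)
    (h0 : Integrable g (gaussianReal 0 1)) (h1 : Integrable g' (gaussianReal 0 1))
    (h2 : Integrable (fun x => x * g x) (gaussianReal 0 1)) :
    ∫ x, x * g x ∂(gaussianReal 0 1) = ∫ x, g' x ∂(gaussianReal 0 1) := by
  rw [integrable_gaussianReal_iff] at h0 h1 h2
  rw [integral_gaussianReal_eq_integral_smul one_ne_zero,
    integral_gaussianReal_eq_integral_smul one_ne_zero]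
  have := integral_mul_deriv_eq_deriv_mul_of_integrable (u := g) (v := gaussianPDFReal 0 1)
    (u' := g') (v' := fun x => -x * gaussianPDFReal 0 1 x) (fun x _ => hg x)
    (fun x _ => hasDerivAt_gaussianPDFReal x)
    (h2.neg.congr (ae_of_all _ fun x => by simp; ring))
    (h1.congr (ae_of_all _ fun x => by simp; ring))
    (h0.congr (ae_of_all _ fun x => by simp; ring))
  rw [← neg_inj, ← integral_neg]
  calc _ = ∫ x, g x * (-x * gaussianPDFReal 0 1 x) := by
        congr 1; ext x; simp; ring
    _ = _ := this
    _ = _ := by congr 2; ext x; simp; ring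

lemma hasDerivAt_insertNth {m : ℕ} (k : Fin (m + 1)) (y : Fin m → ℝ) (t : ℝ) :
    HasDerivAt (fun t : ℝ => (k.insertNth t y : Fin (m + 1) → ℝ)) (Pi.single k 1) t := by
  rw [hasDerivAt_pi]
  intro i
  rcases Fin.eq_self_or_eq_succAbove k i with rfl | ⟨j, rfl⟩
  · simpa using hasDerivAt_id' t
  · simpa using hasDerivAt_const t (y j)

/-- Gaussian integration by parts along a coordinate of `ℝⁿ`. -/
lemma integral_eval_mul_gaussianPi {n : ℕ} (k : Fin n) {g : (Fin n → ℝ) → ℝ}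
    (hg : Differentiable ℝ g) (h0 : Integrable g (gaussianPi n))
    (h1 : Integrable (fun x => fderiv ℝ g x (Pi.single k 1)) (gaussianPi n))
    (h2 : Integrable (fun x => x k * g x) (gaussianPi n)) :
    ∫ x, x k * g x ∂(gaussianPi n) = ∫ x, fderiv ℝ g x (Pi.single k 1) ∂(gaussianPi n) := by
  obtain _ | m := n
  · exact k.elim0
  have mp := (measurePreserving_piFinSuccAbove (fun _ : Fin (m + 1) => gaussianReal 0 1) k).symm
  have key : ∀ f : (Fin (m + 1) → ℝ) → ℝ, Integrable f (gaussianPi (m + 1)) →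
      Integrable (fun z : ℝ × (Fin m → ℝ) => f (k.insertNth z.1 z.2))
        ((gaussianReal 0 1).prod (gaussianPi m)) := fun f hf =>
    (mp.integrable_comp_emb (MeasurableEquiv.measurableEmbedding _)).2 hf
  have key2 : ∀ f : (Fin (m + 1) → ℝ) → ℝ, Integrable f (gaussianPi (m + 1)) →
      ∫ x, f x ∂(gaussianPi (m + 1)) =
        ∫ y, ∫ t, f (k.insertNth t y) ∂(gaussianReal 0 1) ∂(gaussianPi m) := fun f hf => by
    rw [← mp.integral_comp']
    exact integral_prod_symm _ (key f hf)
  rw [key2 _ h1, key2 _ h2]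
  refine integral_congr_ae ?_
  filter_upwards [(key _ h0).prod_left_ae, (key _ h1).prod_left_ae, (key _ h2).prod_left_ae]
    with y hy0 hy1 hy2
  simp only [Fin.insertNth_apply_same] at hy2 ⊢
  exact integral_mul_gaussianReal (fun t =>
    (hg _).hasFDerivAt.comp_hasDerivAt t (hasDerivAt_insertNth k y t)) hy0 hy1 hy2

/-! ### The field `v ↦ ‖v‖ ^ r • v` -/

section NormPower

variable {V : Type*} [NormedAddCommGroup V] [InnerProductSpace ℝ V]

/-- For `r > 0` the field `v ↦ ‖v‖ ^ r • v` is differentiable also at the origin, and its derivative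
is bounded by the derivative `(r + 1) * t ^ r` of `t ↦ t ^ (r + 1)`. -/
lemma exists_hasFDerivAt_norm_rpow_smul {r : ℝ} (hr : 0 ≤ r) (v : V) :
    ∃ D : V →L[ℝ] V, HasFDerivAt (fun v : V => ‖v‖ ^ r • v) D v ∧ ‖D‖ ≤ (r + 1) * ‖v‖ ^ r := by
  rcases hr.eq_or_lt with rfl | hr
  · refine ⟨.id ℝ V, by simpa using! hasFDerivAt_id v, ?_⟩
    simpa using ContinuousLinearMap.norm_id_le
  rcases eq_or_ne v 0 with rfl | hv
  · refine ⟨0, .of_isLittleO ?_, by rw [norm_zero (E := V →L[ℝ] V)]; positivity⟩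
    have h1 : Filter.Tendsto (fun v : V => ‖v‖ ^ r) (nhds 0) (nhds 0) := by
      have : Continuous fun v : V => ‖v‖ ^ r := continuous_norm.rpow_const fun _ => Or.inr hr.le
      simpa [Real.zero_rpow hr.ne'] using this.tendsto 0
    have := ((Asymptotics.isLittleO_one_iff ℝ).2 h1).smul_isBigO
      (Asymptotics.isBigO_refl (fun v : V => v) (nhds 0))
    simpa using this
  have hv0 : 0 < ‖v‖ := norm_pos_iff.2 hv
  have h1 : HasFDerivAt (fun v : V => ‖v‖ ^ r) ((r * ‖v‖ ^ (r - 2)) • innerSL ℝ v) v := by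
    have h2 := (hasStrictFDerivAt_norm_sq v).hasFDerivAt.rpow_const (p := r / 2)
      (Or.inl (by positivity))
    have h3 : (fun v : V => ‖v‖ ^ r) = fun v : V => (‖v‖ ^ 2) ^ (r / 2) := by
      ext v
      rw [← Real.rpow_natCast, ← Real.rpow_mul (norm_nonneg v)]
      congr 1; push_cast; ring
    rw [h3]
    refine h2.congr_fderiv ?_
    rw [← Real.rpow_natCast, ← Real.rpow_mul (norm_nonneg v), ← Nat.cast_smul_eq_nsmul ℝ,
      smul_smul]
    congr 1
    rw [show ((2 : ℕ) : ℝ) * (r / 2 - 1) = r - 2 by push_cast; ring]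
    push_cast; ring
  refine ⟨_, h1.smul (hasFDerivAt_id v), ?_⟩
  refine ContinuousLinearMap.opNorm_le_bound _ (by positivity) fun w => ?_
  have e : ‖v‖ ^ r = ‖v‖ ^ (r - 2) * (‖v‖ * ‖v‖) := by
    rw [Real.rpow_sub hv0, Real.rpow_two]; field_simp
  simp only [add_apply, ContinuousLinearMap.smulRight_apply,
    smul_apply, ContinuousLinearMap.id_apply, innerSL_apply_apply, smul_eq_mul]
  calc _ ≤ ‖‖v‖ ^ r • w‖ + ‖(r * ‖v‖ ^ (r - 2) * inner ℝ v w) • v‖ := norm_add_le _ _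
    _ ≤ ‖v‖ ^ r * ‖w‖ + r * ‖v‖ ^ (r - 2) * (‖v‖ * ‖w‖) * ‖v‖ := by
        rw [norm_smul, norm_smul, norm_mul, Real.norm_of_nonneg (by positivity : 0 ≤ ‖v‖ ^ r),
          Real.norm_of_nonneg (by positivity : 0 ≤ r * ‖v‖ ^ (r - 2))]
        gcongr
        exact norm_inner_le_norm v w
    _ = _ := by rw [e]; ring

end NormPower

/-! ### The Hilbert–Schmidt norm -/

section HilbertSchmidt

variable {V : Type*} [NormedAddCommGroup V] [InnerProductSpace ℝ V] {n : ℕ}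

/-- The Hilbert–Schmidt norm of a linear map defined on `ℝⁿ` with its Euclidean structure. The
type `Fin n → ℝ` carries the sup norm, so the standard basis is written out. -/
noncomputable def hsNorm (A : (Fin n → ℝ) →L[ℝ] V) : ℝ := √(∑ k, ‖A (Pi.single k 1)‖ ^ 2)

lemma hsNorm_nonneg (A : (Fin n → ℝ) →L[ℝ] V) : 0 ≤ hsNorm A := Real.sqrt_nonneg _

lemma sq_hsNorm (A : (Fin n → ℝ) →L[ℝ] V) : hsNorm A ^ 2 = ∑ k, ‖A (Pi.single k 1)‖ ^ 2 :=
  Real.sq_sqrt (by positivity)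

lemma continuous_hsNorm : Continuous (hsNorm : ((Fin n → ℝ) →L[ℝ] V) → ℝ) := by
  unfold hsNorm; fun_prop

lemma hsNorm_le (A : (Fin n → ℝ) →L[ℝ] V) : hsNorm A ≤ √n * ‖A‖ := by
  rw [hsNorm, Real.sqrt_le_left (by positivity), mul_pow, Real.sq_sqrt (by positivity)]
  calc ∑ k, ‖A (Pi.single k 1)‖ ^ 2 ≤ ∑ _k : Fin n, ‖A‖ ^ 2 := by
        gcongr with k
        refine (A.le_opNorm _).trans ?_
        simp [Pi.norm_single]
    _ = _ := by simp

lemma sum_mul_norm_le_hsNorm (A B : (Fin n → ℝ) →L[ℝ] V) :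
    ∑ k, ‖A (Pi.single k 1)‖ * ‖B (Pi.single k 1)‖ ≤ hsNorm A * hsNorm B :=
  Real.sum_mul_le_sqrt_mul_sqrt _ _ _

lemma map_eq_sum_smul_single (A : (Fin n → ℝ) →L[ℝ] V) (y : Fin n → ℝ) :
    A y = ∑ k, y k • A (Pi.single k 1) := by
  conv_lhs => rw [pi_eq_sum_univ' y]
  simp [map_sum]

/-- The second moment of the Gaussian vector `A y` is the square of the Hilbert–Schmidt norm. -/
lemma integral_norm_sq_map_gaussianPi (A : (Fin n → ℝ) →L[ℝ] V) :
    ∫ y, ‖A y‖ ^ 2 ∂(gaussianPi n) = hsNorm A ^ 2 := by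
  have hm : HasMoments (gaussianPi n) := hasMoments_of_isGaussian _
  have hp : ∀ k : Fin n, PolyGrowth fun y : Fin n → ℝ => y k := fun k =>
    polyGrowth_id.of_le fun y => norm_le_pi_norm y k
  have h : ∀ y : Fin n → ℝ, ‖A y‖ ^ 2 = ∑ k, ∑ l,
      y k * y l * inner ℝ (A (Pi.single k 1)) (A (Pi.single l 1)) := fun y => by
    rw [map_eq_sum_smul_single A y, ← real_inner_self_eq_norm_sq, sum_inner]
    refine Finset.sum_congr rfl fun k _ => ?_
    rw [inner_sum]
    refine Finset.sum_congr rfl fun l _ => ?_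
    rw [real_inner_smul_left, real_inner_smul_right]; ring
  have hi : ∀ k l : Fin n, Integrable (fun y : Fin n → ℝ =>
      y k * y l * inner ℝ (A (Pi.single k 1)) (A (Pi.single l 1))) (gaussianPi n) := fun k l =>
    (hm.integrable ((hp k).mul (hp l)) (by fun_prop)).mul_const _
  simp_rw [h]
  rw [integral_finsetSum _ fun k _ => integrable_finsetSum _ fun l _ => hi k l, sq_hsNorm]
  refine Finset.sum_congr rfl fun k _ => ?_
  rw [integral_finsetSum _ fun l _ => hi k l]
  simp_rw [integral_mul_const, integral_eval_mul_eval_gaussianPi]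
  simp

end HilbertSchmidt

/-! ### Rotations of two independent copies -/

section Rotation

variable {n : ℕ}

lemma measurePreserving_rotation_gaussianPi (θ : ℝ) :
    MeasurePreserving (fun z : (Fin n → ℝ) × (Fin n → ℝ) =>
      (Real.cos θ • z.1 + Real.sin θ • z.2, -Real.sin θ • z.1 + Real.cos θ • z.2))
      ((gaussianPi n).prod (gaussianPi n)) ((gaussianPi n).prod (gaussianPi n)) :=
  ⟨by fun_prop, IsGaussian.map_rotation_eq_self (integral_id_gaussianPi n) θ⟩

/-- The second component of the inverse rotation is again standard Gaussian. -/
lemma measurePreserving_sin_cos_gaussianPi (θ : ℝ) :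
    MeasurePreserving (fun z : (Fin n → ℝ) × (Fin n → ℝ) =>
      Real.sin θ • z.1 + Real.cos θ • z.2)
      ((gaussianPi n).prod (gaussianPi n)) (gaussianPi n) := by
  have h := (measurePreserving_fst (μ := gaussianPi n) (ν := gaussianPi n)).comp
    (measurePreserving_rotation_gaussianPi (n := n) (Real.pi / 2 - θ))
  simpa [Function.comp_def, Real.cos_pi_div_two_sub, Real.sin_pi_div_two_sub] using h

lemma hasDerivAt_rotation (z : (Fin n → ℝ) × (Fin n → ℝ)) (θ : ℝ) :
    HasDerivAt (fun θ : ℝ => Real.cos θ • z.1 + Real.sin θ • z.2)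
      (-Real.sin θ • z.1 + Real.cos θ • z.2) θ :=
  ((Real.hasDerivAt_cos θ).smul_const z.1).add ((Real.hasDerivAt_sin θ).smul_const z.2)

variable {V : Type*} [NormedAddCommGroup V] [InnerProductSpace ℝ V]

lemma continuous_fderiv_rotation {Φ : (Fin n → ℝ) → V} (hΦ : ContDiff ℝ 1 Φ) :
    Continuous fun p : ℝ × (Fin n → ℝ) × (Fin n → ℝ) =>
      fderiv ℝ Φ (Real.cos p.1 • p.2.1 + Real.sin p.1 • p.2.2)
        (-Real.sin p.1 • p.2.1 + Real.cos p.1 • p.2.2) := by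
  have h := hΦ.continuous_fderiv one_ne_zero
  exact (h.comp (by fun_prop)).clm_apply (by fun_prop)

/-- The increment of `Φ` between two points, written along the elliptic arc that joins them. The
velocity `-sin θ x + cos θ y` is the second component of the rotation by `θ` of `(x, y)`, the
position is the first one. -/
lemma sub_eq_integral_rotation [CompleteSpace V] {Φ : (Fin n → ℝ) → V} (hΦ : ContDiff ℝ 1 Φ)
    (z : (Fin n → ℝ) × (Fin n → ℝ)) :
    Φ z.2 - Φ z.1 = ∫ θ in Set.Ioc 0 (Real.pi / 2),
      fderiv ℝ Φ (Real.cos θ • z.1 + Real.sin θ • z.2)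
        (-Real.sin θ • z.1 + Real.cos θ • z.2) := by
  rw [← intervalIntegral.integral_of_le (by positivity)]
  have hc := (continuous_fderiv_rotation hΦ).comp (f := fun θ : ℝ => (θ, z)) (by fun_prop)
  have := intervalIntegral.integral_eq_sub_of_hasDerivAt (a := 0) (b := Real.pi / 2)
    (f := fun θ : ℝ => Φ (Real.cos θ • z.1 + Real.sin θ • z.2))
    (fun θ _ => ((hΦ.differentiable one_ne_zero) _).hasFDerivAt.comp_hasDerivAt θ
      (hasDerivAt_rotation z θ)) (hc.intervalIntegrable _ _)
  rw [this]
  simp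

end Rotation

/-! ### The inequality for `q ≤ 2` -/

section SmallExponent

/-- Jensen's inequality for a power, for a measure which need not have mass one. -/
lemma rpow_lintegral_le {α : Type*} [MeasurableSpace α] {ν : Measure α} {f : α → ENNReal}
    (hf : AEMeasurable f ν) {q : ℝ} (hq : 1 ≤ q) :
    (∫⁻ x, f x ∂ν) ^ q ≤ ν Set.univ ^ (q - 1) * ∫⁻ x, f x ^ q ∂ν := by
  have hq0 : 0 < q := by linarith
  have h := ENNReal.lintegral_mul_norm_pow_le (μ := ν) (f := fun x => f x ^ q) (g := fun _ => 1)
    (hf.pow_const q) aemeasurable_const (p := 1 / q) (q := 1 - 1 / q) (by positivity)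
    (by rw [sub_nonneg, div_le_one hq0]; exact hq) (by ring)
  simp only [ENNReal.one_rpow, mul_one, ← ENNReal.rpow_mul, mul_one_div_cancel hq0.ne',
    ENNReal.rpow_one, lintegral_one] at h
  refine (ENNReal.rpow_le_rpow h hq0.le).trans_eq ?_
  rw [ENNReal.mul_rpow_of_nonneg _ _ hq0.le, ← ENNReal.rpow_mul, ← ENNReal.rpow_mul, mul_comm]
  congr 2
  · field_simp
  · rw [one_div_mul_cancel hq0.ne', ENNReal.rpow_one]

variable {V : Type*} [NormedAddCommGroup V] [InnerProductSpace ℝ V] {n : ℕ}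

/-- For exponents `q ≤ 2` the `q`-th moment of a Gaussian vector is controlled by the second one,
with constant one. -/
lemma lintegral_enorm_map_gaussianPi_rpow_le (A : (Fin n → ℝ) →L[ℝ] V) {q : ℝ} (hq : 0 < q)
    (hq2 : q ≤ 2) : ∫⁻ y, ‖A y‖ₑ ^ q ∂(gaussianPi n) ≤ ENNReal.ofReal (hsNorm A) ^ q := by
  have hm : Measurable fun y => ‖A y‖ₑ := A.continuous.enorm.measurable
  have h := rpow_lintegral_le (ν := gaussianPi n) (f := fun y => ‖A y‖ₑ ^ q)
    (hm.pow_const q).aemeasurable (q := 2 / q) (by rwa [le_div_iff₀ hq, one_mul])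
  simp only [measure_univ, ENNReal.one_rpow, one_mul, ← ENNReal.rpow_mul,
    mul_div_cancel₀ _ hq.ne'] at h
  have h2 : ∫⁻ y, ‖A y‖ₑ ^ (2 : ℝ) ∂(gaussianPi n) = ENNReal.ofReal (hsNorm A) ^ (2 : ℝ) := by
    rw [ENNReal.ofReal_rpow_of_nonneg (hsNorm_nonneg A) (by norm_num), Real.rpow_two,
      ← integral_norm_sq_map_gaussianPi, ofReal_integral_eq_lintegral_ofReal]
    · congr 1; ext y
      rw [← ofReal_norm, ENNReal.ofReal_rpow_of_nonneg (norm_nonneg _) (by norm_num),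
        Real.rpow_two]
    · refine (hasMoments_of_isGaussian (gaussianPi n)).integrable ?_ (by fun_prop)
      refine ((polyGrowth_id.norm.pow 2)).of_norm_le (‖A‖ ^ 2) fun y => ?_
      rw [Real.norm_of_nonneg (by positivity), Real.norm_of_nonneg (by positivity), ← mul_pow]
      gcongr
      exact A.le_opNorm y
    · exact ae_of_all _ fun y => by positivity
  rw [h2] at h
  have h3 := ENNReal.rpow_le_rpow h (by positivity : 0 ≤ q / 2)
  rwa [← ENNReal.rpow_mul, ← ENNReal.rpow_mul, div_mul_div_cancel₀ hq.ne', div_self two_ne_zero,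
    ENNReal.rpow_one, mul_div_cancel₀ _ two_ne_zero] at h3

variable [CompleteSpace V]

lemma lintegral_enorm_sub_rpow_le {Φ : (Fin n → ℝ) → V} (hΦ : ContDiff ℝ 1 Φ) {q : ℝ}
    (hq : 1 ≤ q) :
    ∫⁻ z, ‖Φ z.2 - Φ z.1‖ₑ ^ q ∂((gaussianPi n).prod (gaussianPi n)) ≤
      ENNReal.ofReal (Real.pi / 2) ^ q *
        ∫⁻ z, ‖fderiv ℝ Φ z.1 z.2‖ₑ ^ q ∂((gaussianPi n).prod (gaussianPi n)) := by
  have hc := continuous_fderiv_rotation hΦ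
  have hc0 : Continuous fun z : (Fin n → ℝ) × (Fin n → ℝ) => fderiv ℝ Φ z.1 z.2 :=
    ((hΦ.continuous_fderiv one_ne_zero).comp continuous_fst).clm_apply continuous_snd
  have hvol : (volume.restrict (Set.Ioc 0 (Real.pi / 2))) Set.univ =
      ENNReal.ofReal (Real.pi / 2) := by simp
  have hpi : ENNReal.ofReal (Real.pi / 2) ≠ 0 := by
    simp [Real.pi_pos]
  calc _ ≤ ∫⁻ z, ENNReal.ofReal (Real.pi / 2) ^ (q - 1) *
          (∫⁻ θ in Set.Ioc 0 (Real.pi / 2), ‖fderiv ℝ Φ (Real.cos θ • z.1 + Real.sin θ • z.2)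
            (-Real.sin θ • z.1 + Real.cos θ • z.2)‖ₑ ^ q) ∂((gaussianPi n).prod (gaussianPi n)) := by
        refine lintegral_mono fun z => ?_
        rw [sub_eq_integral_rotation hΦ z]
        refine (ENNReal.rpow_le_rpow (enorm_integral_le_lintegral_enorm _) (by linarith)).trans ?_
        refine (rpow_lintegral_le ?_ hq).trans_eq (by rw [hvol])
        exact (hc.comp (f := fun θ : ℝ => (θ, z)) (by fun_prop)).enorm.measurable.aemeasurable
    _ = ENNReal.ofReal (Real.pi / 2) ^ (q - 1) * ∫⁻ θ in Set.Ioc 0 (Real.pi / 2), ∫⁻ z,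
          ‖fderiv ℝ Φ (Real.cos θ • z.1 + Real.sin θ • z.2)
            (-Real.sin θ • z.1 + Real.cos θ • z.2)‖ₑ ^ q ∂((gaussianPi n).prod (gaussianPi n)) := by
        rw [lintegral_const_mul' _ _ (ENNReal.rpow_ne_top_of_ne_zero hpi (by simp)),
          lintegral_lintegral_swap]
        exact ((hc.comp continuous_swap).enorm.measurable.pow_const q).aemeasurable
    _ = ENNReal.ofReal (Real.pi / 2) ^ (q - 1) * ∫⁻ θ in Set.Ioc 0 (Real.pi / 2), ∫⁻ z,
          ‖fderiv ℝ Φ z.1 z.2‖ₑ ^ q ∂((gaussianPi n).prod (gaussianPi n)) := by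
        congr 1
        refine lintegral_congr fun θ => ?_
        exact (measurePreserving_rotation_gaussianPi θ).lintegral_comp
          (hc0.enorm.measurable.pow_const q)
    _ = _ := by
        rw [lintegral_const, hvol, mul_comm (∫⁻ z, _ ∂_), ← mul_assoc]
        congr 1
        conv_lhs => rw [← ENNReal.rpow_one (ENNReal.ofReal (Real.pi / 2)), ← ENNReal.rpow_mul,
          one_mul, ← ENNReal.rpow_add _ _ hpi (by simp), sub_add_cancel]

/-- The Gaussian Poincaré inequality on `ℝⁿ` with constant `π / 2`. -/
lemma lintegral_enorm_sub_integral_rpow_le {Φ : (Fin n → ℝ) → V} (hΦ : ContDiff ℝ 1 Φ)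
    (hi : Integrable Φ (gaussianPi n)) {q : ℝ} (hq : 1 ≤ q) (hq2 : q ≤ 2) :
    ∫⁻ x, ‖Φ x - ∫ y, Φ y ∂(gaussianPi n)‖ₑ ^ q ∂(gaussianPi n) ≤
      ENNReal.ofReal (Real.pi / 2) ^ q *
        ∫⁻ x, ENNReal.ofReal (hsNorm (fderiv ℝ Φ x)) ^ q ∂(gaussianPi n) := by
  have hc0 : Continuous fun z : (Fin n → ℝ) × (Fin n → ℝ) => fderiv ℝ Φ z.1 z.2 :=
    ((hΦ.continuous_fderiv one_ne_zero).comp continuous_fst).clm_apply continuous_snd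
  have hcΦ := hΦ.continuous
  calc _ ≤ ∫⁻ x, ∫⁻ y, ‖Φ y - Φ x‖ₑ ^ q ∂(gaussianPi n) ∂(gaussianPi n) := by
        refine lintegral_mono fun x => ?_
        have h1 : Φ x - ∫ y, Φ y ∂(gaussianPi n) = -∫ y, (Φ y - Φ x) ∂(gaussianPi n) := by
          rw [integral_sub hi (integrable_const _)]; simp
        rw [h1, enorm_neg]
        refine (ENNReal.rpow_le_rpow (enorm_integral_le_lintegral_enorm _) (by linarith)).trans ?_
        refine (rpow_lintegral_le ?_ hq).trans_eq (by simp)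
        exact (Continuous.enorm (by fun_prop)).measurable.aemeasurable
    _ = ∫⁻ z, ‖Φ z.2 - Φ z.1‖ₑ ^ q ∂((gaussianPi n).prod (gaussianPi n)) := by
        rw [lintegral_prod]
        exact ((Continuous.enorm (by fun_prop)).measurable.pow_const q).aemeasurable
    _ ≤ _ := lintegral_enorm_sub_rpow_le hΦ hq
    _ ≤ _ := by
        gcongr
        rw [lintegral_prod _ (hc0.enorm.measurable.pow_const q).aemeasurable]
        exact lintegral_mono fun x =>
          lintegral_enorm_map_gaussianPi_rpow_le _ (by linarith) hq2

end SmallExponent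

/-! ### The inequality for `q ≥ 2` -/

section LargeExponent

lemma integral_rpow_mul_rpow_le {α : Type*} [MeasurableSpace α] {μ : Measure α} {f g : α → ℝ}
    (hf : Integrable f μ) (hg : Integrable g μ) (hf0 : ∀ x, 0 ≤ f x) (hg0 : ∀ x, 0 ≤ g x)
    {s t : ℝ} (hs : 0 ≤ s) (ht : 0 ≤ t) (hst : s + t = 1) :
    ∫ x, f x ^ s * g x ^ t ∂μ ≤ (∫ x, f x ∂μ) ^ s * (∫ x, g x ∂μ) ^ t := by
  have h := ENNReal.lintegral_mul_norm_pow_le (μ := μ) (f := fun x => ENNReal.ofReal (f x))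
    (g := fun x => ENNReal.ofReal (g x)) hf.aestronglyMeasurable.aemeasurable.ennreal_ofReal
    hg.aestronglyMeasurable.aemeasurable.ennreal_ofReal hs ht hst
  have e : ∀ x, ENNReal.ofReal (f x) ^ s * ENNReal.ofReal (g x) ^ t =
      ENNReal.ofReal (f x ^ s * g x ^ t) := fun x => by
    rw [ENNReal.ofReal_mul (Real.rpow_nonneg (hf0 x) s),
      ENNReal.ofReal_rpow_of_nonneg (hf0 x) hs, ENNReal.ofReal_rpow_of_nonneg (hg0 x) ht]
  have hF := integral_nonneg (μ := μ) (f := f) hf0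
  have hG := integral_nonneg (μ := μ) (f := g) hg0
  simp_rw [e] at h
  rw [← ofReal_integral_eq_lintegral_ofReal hf (ae_of_all _ hf0),
    ← ofReal_integral_eq_lintegral_ofReal hg (ae_of_all _ hg0),
    ENNReal.ofReal_rpow_of_nonneg hF hs, ENNReal.ofReal_rpow_of_nonneg hG ht,
    ← ENNReal.ofReal_mul (Real.rpow_nonneg hF s)] at h
  rw [integral_eq_lintegral_of_nonneg_ae
    (ae_of_all _ fun x => mul_nonneg (Real.rpow_nonneg (hf0 x) s) (Real.rpow_nonneg (hg0 x) t))
    ((hf.aestronglyMeasurable.aemeasurable.pow_const s).mul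
      (hg.aestronglyMeasurable.aemeasurable.pow_const t)).aestronglyMeasurable]
  exact ENNReal.toReal_le_of_le_ofReal
    (mul_nonneg (Real.rpow_nonneg hF s) (Real.rpow_nonneg hG t)) h

lemma _root_.MeasureTheory.MeasurePreserving.integral_comp_of_aestronglyMeasurable {α β G : Type*}
    [MeasurableSpace α] [MeasurableSpace β] [NormedAddCommGroup G] [NormedSpace ℝ G]
    {μ : Measure α} {ν : Measure β} {T : α → β} (hT : MeasurePreserving T μ ν) {f : β → G}
    (hf : AEStronglyMeasurable f ν) : ∫ x, f (T x) ∂μ = ∫ y, f y ∂ν := by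
  rw [← hT.map_eq] at hf ⊢
  exact (integral_map hT.measurable.aemeasurable hf).symm

variable {V : Type*} [NormedAddCommGroup V] [InnerProductSpace ℝ V] {n : ℕ}

lemma polyGrowth_hsNorm_fderiv {Φ : (Fin n → ℝ) → V} (h : PolyGrowth (fderiv ℝ Φ)) :
    PolyGrowth fun x => hsNorm (fderiv ℝ Φ x) :=
  h.of_norm_le (√n) fun x => by
    rw [Real.norm_of_nonneg (hsNorm_nonneg _)]; exact hsNorm_le _

lemma polyGrowth_norm_rpow_smul {Φ : (Fin n → ℝ) → V} (h : PolyGrowth Φ) {r : ℝ} (hr : 0 ≤ r) :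
    PolyGrowth fun x => ‖Φ x‖ ^ r • Φ x :=
  (h.norm_rpow hr).of_le_mul h fun _ => norm_smul_le _ _

lemma continuous_norm_rpow_smul {Φ : (Fin n → ℝ) → V} (h : Continuous Φ) {r : ℝ} (hr : 0 ≤ r) :
    Continuous fun x => ‖Φ x‖ ^ r • Φ x :=
  (h.norm.rpow_const fun _ => Or.inr hr).smul h

/-- Gaussian integration by parts in `w` of the inner product of `A w` with the field
`‖Φ‖ ^ r • Φ` at `a + c • w`. In the application `a = sin θ • u`, `c = cos θ` and `A` is the
derivative of `Φ` at `u`. -/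
lemma integral_inner_map_norm_rpow_smul_le {Φ : (Fin n → ℝ) → V} (hΦ : ContDiff ℝ 1 Φ)
    (hg : PolyGrowth Φ) (hg' : PolyGrowth (fderiv ℝ Φ)) {r : ℝ} (hr : 0 ≤ r)
    (A : (Fin n → ℝ) →L[ℝ] V) (a : Fin n → ℝ) {c : ℝ} (hc : 0 ≤ c) :
    ∫ w, inner ℝ (A w) (‖Φ (a + c • w)‖ ^ r • Φ (a + c • w)) ∂(gaussianPi n) ≤
      ∫ w, c * (r + 1) * (hsNorm A * hsNorm (fderiv ℝ Φ (a + c • w)) * ‖Φ (a + c • w)‖ ^ r)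
        ∂(gaussianPi n) := by
  have hm : HasMoments (gaussianPi n) := hasMoments_of_isGaussian _
  have haff : PolyGrowth fun w : Fin n → ℝ => a + c • w :=
    (polyGrowth_const a).add (polyGrowth_id.of_norm_le ‖c‖ fun w => (norm_smul_le _ _))
  have hcaff : Continuous fun w : Fin n → ℝ => a + c • w := by fun_prop
  have hcΦ := hΦ.continuous
  have hcΦ' := hΦ.continuous_fderiv one_ne_zero
  set g : Fin n → (Fin n → ℝ) → ℝ := fun k w =>
    inner ℝ (A (Pi.single k 1)) (‖Φ (a + c • w)‖ ^ r • Φ (a + c • w)) with hgdef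
  have hder : ∀ k w, ∃ g' : (Fin n → ℝ) →L[ℝ] ℝ, HasFDerivAt (g k) g' w ∧
      |g' (Pi.single k 1)| ≤ c * (r + 1) * ‖Φ (a + c • w)‖ ^ r *
        (‖A (Pi.single k 1)‖ * ‖fderiv ℝ Φ (a + c • w) (Pi.single k 1)‖) := fun k w => by
    obtain ⟨D, hD, hDb⟩ := exists_hasFDerivAt_norm_rpow_smul hr (Φ (a + c • w))
    have h1 : HasFDerivAt (fun w : Fin n → ℝ => a + c • w) (c • ContinuousLinearMap.id ℝ _) w :=
      ((hasFDerivAt_id w).const_smul c).const_add a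
    have h2 := ((hΦ.differentiable one_ne_zero) (a + c • w)).hasFDerivAt.comp w h1
    have h3 := hD.comp w h2
    have h4 := (innerSL ℝ (A (Pi.single k 1))).hasFDerivAt.comp w h3
    refine ⟨_, h4, ?_⟩
    simp only [ContinuousLinearMap.comp_apply, smul_apply, ContinuousLinearMap.id_apply, map_smul,
      innerSL_apply_apply, smul_eq_mul]
    rw [abs_mul, abs_of_nonneg hc]
    calc _ ≤ c * (‖A (Pi.single k 1)‖ * (((r + 1) * ‖Φ (a + c • w)‖ ^ r) *
            ‖fderiv ℝ Φ (a + c • w) (Pi.single k 1)‖)) := by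
          gcongr
          refine (abs_real_inner_le_norm _ _).trans ?_
          gcongr
          exact D.le_of_opNorm_le hDb _
      _ = _ := by ring
  have hdiff : ∀ k, Differentiable ℝ (g k) := fun k w => by
    obtain ⟨g', h, -⟩ := hder k w
    exact h.differentiableAt
  have hbound : ∀ k w, |fderiv ℝ (g k) w (Pi.single k 1)| ≤ c * (r + 1) * ‖Φ (a + c • w)‖ ^ r *
        (‖A (Pi.single k 1)‖ * ‖fderiv ℝ Φ (a + c • w) (Pi.single k 1)‖) := fun k w => by
    obtain ⟨g', h, hb⟩ := hder k w
    rwa [h.fderiv]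
  have hGg : PolyGrowth fun w : Fin n → ℝ => ‖Φ (a + c • w)‖ ^ r • Φ (a + c • w) :=
    (polyGrowth_norm_rpow_smul hg hr).comp haff
  have hGc : Continuous fun w : Fin n → ℝ => ‖Φ (a + c • w)‖ ^ r • Φ (a + c • w) :=
    (continuous_norm_rpow_smul hcΦ hr).comp hcaff
  have hgg : ∀ k, PolyGrowth (g k) := fun k =>
    (polyGrowth_const (A (Pi.single k 1))).of_le_mul hGg fun w => norm_inner_le_norm _ _
  have hgc : ∀ k, Continuous (g k) := fun k => continuous_const.inner hGc
  have hcoord : ∀ k : Fin n, PolyGrowth fun w : Fin n → ℝ => w k := fun k =>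
    polyGrowth_id.of_le fun w => norm_le_pi_norm w k
  have hi0 : ∀ k, Integrable (g k) (gaussianPi n) := fun k =>
    hm.integrable (hgg k) (hgc k).aestronglyMeasurable
  have hi1 : ∀ k, Integrable (fun w => fderiv ℝ (g k) w (Pi.single k 1)) (gaussianPi n) := by
    intro k
    refine hm.integrable ?_ (measurable_fderiv_apply_const ℝ (g k) _).aestronglyMeasurable
    have h1 : PolyGrowth fun w : Fin n → ℝ => ‖Φ (a + c • w)‖ ^ r := (hg.norm_rpow hr).comp haff
    have h2 : PolyGrowth fun w : Fin n → ℝ => fderiv ℝ Φ (a + c • w) := hg'.comp haff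
    refine ((polyGrowth_const
      (c * (r + 1) * ‖A (Pi.single k 1)‖ * ‖(Pi.single k 1 : Fin n → ℝ)‖)).mul h1).of_le_mul h2
        fun w => ?_
    refine (hbound k w).trans ?_
    rw [Real.norm_of_nonneg (by positivity)]
    calc _ ≤ c * (r + 1) * ‖Φ (a + c • w)‖ ^ r * (‖A (Pi.single k 1)‖ *
          (‖fderiv ℝ Φ (a + c • w)‖ * ‖(Pi.single k 1 : Fin n → ℝ)‖)) := by
          gcongr
          exact ContinuousLinearMap.le_opNorm _ _
      _ = _ := by ring
  have hi2 : ∀ k, Integrable (fun w => w k * g k w) (gaussianPi n) := fun k =>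
    hm.integrable ((hcoord k).mul (hgg k))
      ((continuous_apply k).mul (hgc k)).aestronglyMeasurable
  calc _ = ∫ w, ∑ k, w k * g k w ∂(gaussianPi n) := by
        congr 1; ext w
        rw [map_eq_sum_smul_single A w, sum_inner]
        simp only [real_inner_smul_left, hgdef]
    _ = ∫ w, ∑ k, fderiv ℝ (g k) w (Pi.single k 1) ∂(gaussianPi n) := by
        rw [integral_finsetSum _ fun k _ => hi2 k, integral_finsetSum _ fun k _ => hi1 k]
        exact Finset.sum_congr rfl fun k _ =>
          integral_eval_mul_gaussianPi k (hdiff k) (hi0 k) (hi1 k) (hi2 k)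
    _ ≤ _ := by
        refine integral_mono (integrable_finsetSum _ fun k _ => hi1 k) ?_ fun w => ?_
        · refine hm.integrable ?_ ?_
          · exact (polyGrowth_const _).mul (((polyGrowth_const _).mul
              ((polyGrowth_hsNorm_fderiv hg').comp haff)).mul ((hg.norm_rpow hr).comp haff))
          · have h1 := (continuous_hsNorm.comp hcΦ').comp hcaff
            have h2 : Continuous fun w : Fin n → ℝ => ‖Φ (a + c • w)‖ ^ r :=
              (hcΦ.comp hcaff).norm.rpow_const fun _ => Or.inr hr
            exact (continuous_const.mul ((continuous_const.mul h1).mul h2)).aestronglyMeasurable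
        · calc ∑ k, fderiv ℝ (g k) w (Pi.single k 1)
              ≤ ∑ k, c * (r + 1) * ‖Φ (a + c • w)‖ ^ r *
                (‖A (Pi.single k 1)‖ * ‖fderiv ℝ Φ (a + c • w) (Pi.single k 1)‖) :=
                Finset.sum_le_sum fun k _ => (le_abs_self _).trans (hbound k w)
            _ ≤ c * (r + 1) * ‖Φ (a + c • w)‖ ^ r *
                (hsNorm A * hsNorm (fderiv ℝ Φ (a + c • w))) := by
                rw [← Finset.mul_sum]
                gcongr
                exact sum_mul_norm_le_hsNorm _ _
            _ = _ := by ring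

/-- Hölder's inequality with the exponents `q`, `q` and `q / (q - 2)`, for functions of the two
standard Gaussian vectors `u` and `sin θ • u + cos θ • w`. -/
lemma integral_hsNorm_mul_le {Φ : (Fin n → ℝ) → V} (hΦ : ContDiff ℝ 1 Φ)
    (hg : PolyGrowth Φ) (hg' : PolyGrowth (fderiv ℝ Φ)) {q : ℝ} (hq : 2 ≤ q) (θ : ℝ) :
    ∫ z, hsNorm (fderiv ℝ Φ z.1) * hsNorm (fderiv ℝ Φ (Real.sin θ • z.1 + Real.cos θ • z.2)) *
        ‖Φ (Real.sin θ • z.1 + Real.cos θ • z.2)‖ ^ (q - 2)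
        ∂((gaussianPi n).prod (gaussianPi n)) ≤
      (∫ x, hsNorm (fderiv ℝ Φ x) ^ q ∂(gaussianPi n)) ^ (2 / q) *
        (∫ x, ‖Φ x‖ ^ q ∂(gaussianPi n)) ^ (1 - 2 / q) := by
  have hq0 : 0 < q := by linarith
  have hm : HasMoments (gaussianPi n) := hasMoments_of_isGaussian _
  have hcΦ := hΦ.continuous
  have hcN : Continuous fun x => hsNorm (fderiv ℝ Φ x) :=
    continuous_hsNorm.comp (hΦ.continuous_fderiv one_ne_zero)
  have hgN := polyGrowth_hsNorm_fderiv hg'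
  set μ := (gaussianPi n).prod (gaussianPi n) with hμ
  have mp2 := measurePreserving_sin_cos_gaussianPi (n := n) θ
  have mp1 := measurePreserving_fst (μ := gaussianPi n) (ν := gaussianPi n)
  have hN : Integrable (fun x => hsNorm (fderiv ℝ Φ x) ^ q) (gaussianPi n) :=
    hm.integrable ((hgN.norm_rpow hq0.le).of_le fun x => by
        rw [Real.norm_of_nonneg (hsNorm_nonneg _)])
      (hcN.rpow_const fun _ => Or.inr hq0.le).aestronglyMeasurable
  have hB : Integrable (fun x => ‖Φ x‖ ^ q) (gaussianPi n) :=
    hm.integrable (hg.norm_rpow hq0.le)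
      (hcΦ.norm.rpow_const fun _ => Or.inr hq0.le).aestronglyMeasurable
  have hpow : ∀ t : ℝ, 0 ≤ t → (t ^ q) ^ (2 / q) = t ^ 2 := fun t ht => by
    rw [← Real.rpow_mul ht, mul_div_cancel₀ _ hq0.ne', Real.rpow_two]
  have hpow' : ∀ t : ℝ, 0 ≤ t → (t ^ q) ^ (1 - 2 / q) = t ^ (q - 2) := fun t ht => by
    rw [← Real.rpow_mul ht]; congr 1; field_simp
  have hmμ : HasMoments μ := hm.prod hm
  have hcS : Continuous fun z : (Fin n → ℝ) × (Fin n → ℝ) =>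
      Real.sin θ • z.1 + Real.cos θ • z.2 := by fun_prop
  have hgS : PolyGrowth fun z : (Fin n → ℝ) × (Fin n → ℝ) =>
      Real.sin θ • z.1 + Real.cos θ • z.2 :=
    ((polyGrowth_id.of_le norm_fst_le).of_norm_le _ fun z => norm_smul_le _ z.1).add
      ((polyGrowth_id.of_le norm_snd_le).of_norm_le _ fun z => norm_smul_le _ z.2)
  have key : ∀ T : (Fin n → ℝ) × (Fin n → ℝ) → (Fin n → ℝ), MeasurePreserving T μ (gaussianPi n) →
      Continuous T → PolyGrowth T →
      Integrable (fun z => hsNorm (fderiv ℝ Φ (T z)) ^ 2 *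
        ‖Φ (Real.sin θ • z.1 + Real.cos θ • z.2)‖ ^ (q - 2)) μ ∧
      ∫ z, hsNorm (fderiv ℝ Φ (T z)) ^ 2 *
        ‖Φ (Real.sin θ • z.1 + Real.cos θ • z.2)‖ ^ (q - 2) ∂μ ≤
      (∫ x, hsNorm (fderiv ℝ Φ x) ^ q ∂(gaussianPi n)) ^ (2 / q) *
        (∫ x, ‖Φ x‖ ^ q ∂(gaussianPi n)) ^ (1 - 2 / q) := by
    intro T hT hTc hTg
    constructor
    · refine hmμ.integrable (((hgN.comp hTg).pow 2).mul ((hg.comp hgS).norm_rpow (by linarith))) ?_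
      exact (((hcN.comp hTc).pow 2).mul ((hcΦ.comp hcS).norm.rpow_const
        fun _ => Or.inr (by linarith))).aestronglyMeasurable
    · have h := integral_rpow_mul_rpow_le (μ := μ) (s := 2 / q) (t := 1 - 2 / q)
        (hT.integrable_comp_of_integrable hN) (mp2.integrable_comp_of_integrable hB)
        (fun z => Real.rpow_nonneg (hsNorm_nonneg _) _)
        (fun z => by simp only [Function.comp]; positivity)
        (by positivity) (by rw [sub_nonneg, div_le_one hq0]; exact hq) (by ring)
      simp only [Function.comp, hpow _ (hsNorm_nonneg _), hpow' _ (norm_nonneg _)] at h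
      rwa [hT.integral_comp_of_aestronglyMeasurable (f := fun x => hsNorm (fderiv ℝ Φ x) ^ q)
          hN.aestronglyMeasurable,
        mp2.integral_comp_of_aestronglyMeasurable (f := fun x => ‖Φ x‖ ^ q)
          hB.aestronglyMeasurable] at h
  obtain ⟨i1, b1⟩ := key _ mp1 continuous_fst (polyGrowth_id.of_le norm_fst_le)
  obtain ⟨i2, b2⟩ := key _ mp2 hcS hgS
  -- AM-GM splits the product into two terms, each needing Hölder for two functions only, which
  -- also covers `q = 2`
  refine (integral_mono_of_nonneg (ae_of_all _ fun z => ?_) ((i1.add i2).div_const 2)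
    (ae_of_all _ fun z => ?_)).trans ?_
  · have := hsNorm_nonneg (fderiv ℝ Φ z.1)
    have := hsNorm_nonneg (fderiv ℝ Φ (Real.sin θ • z.1 + Real.cos θ • z.2))
    simp only [Pi.zero_apply]
    positivity
  · have h0 : 0 ≤ ‖Φ (Real.sin θ • z.1 + Real.cos θ • z.2)‖ ^ (q - 2) := by positivity
    have h1 := two_mul_le_add_sq (hsNorm (fderiv ℝ Φ z.1))
      (hsNorm (fderiv ℝ Φ (Real.sin θ • z.1 + Real.cos θ • z.2)))
    simp only [Pi.add_apply]
    nlinarith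
  · rw [integral_div, integral_add' i1 i2]
    linarith

/-- The covariance of `Φ` and `‖Φ‖ ^ (q - 2) • Φ`, computed by rotating one of two independent
copies into the other. -/
lemma integral_norm_rpow_le_of_integral_eq_zero [CompleteSpace V] {Φ : (Fin n → ℝ) → V}
    (hΦ : ContDiff ℝ 1 Φ) (hg : PolyGrowth Φ) (hg' : PolyGrowth (fderiv ℝ Φ))
    (h0 : ∫ x, Φ x ∂(gaussianPi n) = 0) {q : ℝ} (hq : 2 ≤ q) :
    ∫ x, ‖Φ x‖ ^ q ∂(gaussianPi n) ≤
      (q - 1) * ((∫ x, hsNorm (fderiv ℝ Φ x) ^ q ∂(gaussianPi n)) ^ (2 / q) *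
        (∫ x, ‖Φ x‖ ^ q ∂(gaussianPi n)) ^ (1 - 2 / q)) := by
  have hr : 0 ≤ q - 2 := by linarith
  have hm : HasMoments (gaussianPi n) := hasMoments_of_isGaussian _
  have hmμ := hm.prod hm
  have hcΦ := hΦ.continuous
  have hcΦ' := hΦ.continuous_fderiv one_ne_zero
  have hcN : Continuous fun x => hsNorm (fderiv ℝ Φ x) := continuous_hsNorm.comp hcΦ'
  have hgN := polyGrowth_hsNorm_fderiv hg'
  set M := (∫ x, hsNorm (fderiv ℝ Φ x) ^ q ∂(gaussianPi n)) ^ (2 / q) *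
        (∫ x, ‖Φ x‖ ^ q ∂(gaussianPi n)) ^ (1 - 2 / q) with hM
  set G : (Fin n → ℝ) → V := fun x => ‖Φ x‖ ^ (q - 2) • Φ x with hG
  have hGc : Continuous G := continuous_norm_rpow_smul hcΦ hr
  have hGg : PolyGrowth G := polyGrowth_norm_rpow_smul hg hr
  set μ := (gaussianPi n).prod (gaussianPi n) with hμ
  have hfst : PolyGrowth fun z : (Fin n → ℝ) × (Fin n → ℝ) => z.1 := polyGrowth_id.of_le norm_fst_le
  have hsnd : PolyGrowth fun z : (Fin n → ℝ) × (Fin n → ℝ) => z.2 := polyGrowth_id.of_le norm_snd_le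
  have hinner : ∀ x, inner ℝ (Φ x) (G x) = ‖Φ x‖ ^ q := fun x => by
    rw [hG, real_inner_smul_right, real_inner_self_eq_norm_sq, ← Real.rpow_two,
      ← Real.rpow_add_of_nonneg (norm_nonneg _) hr zero_le_two, sub_add_cancel]
  -- the integrand on `[0, π / 2] × ℝⁿ × ℝⁿ`
  set J : ℝ → (Fin n → ℝ) × (Fin n → ℝ) → ℝ := fun θ z =>
    inner ℝ (fderiv ℝ Φ (Real.cos θ • z.1 + Real.sin θ • z.2)
        (-Real.sin θ • z.1 + Real.cos θ • z.2)) (G z.2) with hJ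
  have hJi : Integrable (Function.uncurry J)
      ((volume.restrict (Set.Ioc 0 (Real.pi / 2))).prod μ) := by
    refine ((hasMoments_restrict_Ioc 0 (Real.pi / 2)).prod hmμ).integrable ?_ ?_
    · have hz : PolyGrowth fun p : ℝ × (Fin n → ℝ) × (Fin n → ℝ) => p.2 :=
        polyGrowth_id.of_le norm_snd_le
      have h1 : ∀ (f : ℝ → ℝ), (∀ θ, |f θ| ≤ 1) →
          ∀ h : ℝ × (Fin n → ℝ) × (Fin n → ℝ) → (Fin n → ℝ), PolyGrowth h →
          PolyGrowth fun p : ℝ × (Fin n → ℝ) × (Fin n → ℝ) => f p.1 • h p := fun f hf h hh =>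
        hh.of_le fun p => by
          rw [norm_smul]; exact mul_le_of_le_one_left (norm_nonneg _) (hf p.1)
      have hu := (h1 _ Real.abs_cos_le_one _ (hfst.comp hz)).add
        (h1 _ Real.abs_sin_le_one _ (hsnd.comp hz))
      have hw := (h1 (fun θ => -Real.sin θ) (fun θ => by rw [abs_neg]; exact Real.abs_sin_le_one θ)
        _ (hfst.comp hz)).add (h1 _ Real.abs_cos_le_one _ (hsnd.comp hz))
      have h2 := ((hg'.comp hu).norm.mul hw.norm).mul (hGg.comp (hsnd.comp hz)).norm
      refine h2.of_le fun p => ?_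
      rw [norm_mul, norm_mul, norm_norm, norm_norm, norm_norm]
      refine (norm_inner_le_norm _ _).trans ?_
      gcongr
      exact ContinuousLinearMap.le_opNorm _ _
    · exact ((continuous_fderiv_rotation hΦ).inner
        (hGc.comp (continuous_snd.comp continuous_snd))).aestronglyMeasurable
  have step1 : ∫ x, ‖Φ x‖ ^ q ∂(gaussianPi n) = ∫ z, inner ℝ (Φ z.2 - Φ z.1) (G z.2) ∂μ := by
    have i2 : Integrable (fun z : (Fin n → ℝ) × (Fin n → ℝ) => inner ℝ (Φ z.2) (G z.2)) μ :=
      hmμ.integrable ((hg.comp hsnd).of_le_mul (hGg.comp hsnd) fun z => norm_inner_le_norm _ _)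
        (Continuous.aestronglyMeasurable (by fun_prop))
    have i1 : Integrable (fun z : (Fin n → ℝ) × (Fin n → ℝ) => inner ℝ (Φ z.1) (G z.2)) μ :=
      hmμ.integrable ((hg.comp hfst).of_le_mul (hGg.comp hsnd) fun z => norm_inner_le_norm _ _)
        (Continuous.aestronglyMeasurable (by fun_prop))
    have iΦ : Integrable Φ (gaussianPi n) := hm.integrable hg hcΦ.aestronglyMeasurable
    simp_rw [inner_sub_left]
    rw [integral_sub i2 i1, integral_prod_symm _ i1]
    have e1 : ∀ y, ∫ x, inner ℝ (Φ x) (G y) ∂(gaussianPi n) = 0 := fun y => by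
      simp_rw [real_inner_comm (G y)]
      rw [integral_inner iΦ, h0, inner_zero_right]
    simp_rw [e1, hinner]
    rw [integral_zero, sub_zero]
    exact (measurePreserving_snd.integral_comp_of_aestronglyMeasurable
      (f := fun x => ‖Φ x‖ ^ q) (hcΦ.norm.rpow_const
        fun _ => Or.inr (by linarith)).aestronglyMeasurable).symm
  have step2 : ∫ z, inner ℝ (Φ z.2 - Φ z.1) (G z.2) ∂μ =
      ∫ θ in Set.Ioc 0 (Real.pi / 2), ∫ z, J θ z ∂μ := by
    rw [integral_integral_swap hJi]
    refine integral_congr_ae (ae_of_all _ fun z => ?_)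
    simp only [hJ]
    rw [sub_eq_integral_rotation hΦ z, real_inner_comm, ← integral_inner]
    · simp_rw [real_inner_comm]
    · exact (Continuous.integrableOn_Ioc
        ((continuous_fderiv_rotation hΦ).comp (f := fun θ : ℝ => (θ, z)) (by fun_prop)))
  have step3 : ∀ θ ∈ Set.Ioc 0 (Real.pi / 2), ∫ z, J θ z ∂μ ≤ Real.cos θ * ((q - 1) * M) := by
    intro θ hθ
    have hcos : 0 ≤ Real.cos θ := Real.cos_nonneg_of_mem_Icc ⟨by linarith [hθ.1, Real.pi_pos], hθ.2⟩
    have hS : Continuous fun z : (Fin n → ℝ) × (Fin n → ℝ) =>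
        Real.sin θ • z.1 + Real.cos θ • z.2 := by fun_prop
    have hSg : PolyGrowth fun z : (Fin n → ℝ) × (Fin n → ℝ) =>
        Real.sin θ • z.1 + Real.cos θ • z.2 :=
      (hfst.of_norm_le _ fun z => norm_smul_le _ _).add
        (hsnd.of_norm_le _ fun z => norm_smul_le _ _)
    have hDc : Continuous fun z : (Fin n → ℝ) × (Fin n → ℝ) => fderiv ℝ Φ z.1 z.2 :=
      (hcΦ'.comp continuous_fst).clm_apply continuous_snd
    have hKc : Continuous fun z : (Fin n → ℝ) × (Fin n → ℝ) =>
      inner ℝ (fderiv ℝ Φ z.1 z.2) (G (Real.sin θ • z.1 + Real.cos θ • z.2)) :=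
      hDc.inner (hGc.comp hS)
    have hKi : Integrable (fun z : (Fin n → ℝ) × (Fin n → ℝ) =>
        inner ℝ (fderiv ℝ Φ z.1 z.2) (G (Real.sin θ • z.1 + Real.cos θ • z.2))) μ := by
      refine hmμ.integrable ?_ hKc.aestronglyMeasurable
      refine PolyGrowth.of_le_mul (((hg'.comp hfst).of_le_mul hsnd fun z =>
        ContinuousLinearMap.le_opNorm (fderiv ℝ Φ z.1) z.2)) (hGg.comp hSg)
        fun z => norm_inner_le_norm _ _
    have hRi : Integrable (fun z : (Fin n → ℝ) × (Fin n → ℝ) => Real.cos θ * (q - 2 + 1) *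
        (hsNorm (fderiv ℝ Φ z.1) * hsNorm (fderiv ℝ Φ (Real.sin θ • z.1 + Real.cos θ • z.2)) *
        ‖Φ (Real.sin θ • z.1 + Real.cos θ • z.2)‖ ^ (q - 2))) μ := by
      refine (hmμ.integrable (((hgN.comp hfst).mul (hgN.comp hSg)).mul
        ((hg.comp hSg).norm_rpow hr)) ?_).const_mul _
      exact (((hcN.comp continuous_fst).mul (hcN.comp hS)).mul
        ((hcΦ.comp hS).norm.rpow_const fun _ => Or.inr hr)).aestronglyMeasurable
    calc ∫ z, J θ z ∂μ = ∫ z, inner ℝ (fderiv ℝ Φ z.1 z.2)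
          (G (Real.sin θ • z.1 + Real.cos θ • z.2)) ∂μ := by
          rw [← (measurePreserving_rotation_gaussianPi (n := n)
            θ).integral_comp_of_aestronglyMeasurable hKc.aestronglyMeasurable]
          refine integral_congr_ae (ae_of_all _ fun z => ?_)
          simp only [hJ]
          congr 2
          -- the second component is recovered from the rotated pair
          have := Real.sin_sq_add_cos_sq θ
          simp only [smul_add, smul_smul]
          calc z.2 = (Real.sin θ ^ 2 + Real.cos θ ^ 2) • z.2 := by rw [this, one_smul]
            _ = _ := by module
      _ ≤ ∫ z, Real.cos θ * (q - 2 + 1) * (hsNorm (fderiv ℝ Φ z.1) *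
            hsNorm (fderiv ℝ Φ (Real.sin θ • z.1 + Real.cos θ • z.2)) *
            ‖Φ (Real.sin θ • z.1 + Real.cos θ • z.2)‖ ^ (q - 2)) ∂μ := by
          rw [integral_prod _ hKi, integral_prod _ hRi]
          exact integral_mono hKi.integral_prod_left hRi.integral_prod_left fun u =>
            integral_inner_map_norm_rpow_smul_le hΦ hg hg' hr (fderiv ℝ Φ u) (Real.sin θ • u) hcos
      _ ≤ _ := by
          rw [integral_const_mul, mul_assoc, show q - 2 + 1 = q - 1 by ring]
          gcongr
          · linarith
          · exact integral_hsNorm_mul_le hΦ hg hg' hq θ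
  rw [step1, step2]
  calc _ ≤ ∫ θ in Set.Ioc 0 (Real.pi / 2), Real.cos θ * ((q - 1) * M) :=
        setIntegral_mono_on hJi.integral_prod_left
          (Continuous.integrableOn_Ioc (by fun_prop)) measurableSet_Ioc step3
    _ = _ := by
        rw [integral_mul_const, ← intervalIntegral.integral_of_le (by positivity), integral_cos]
        simp

/-- The Gaussian Poincaré inequality on `ℝⁿ` with constant `√(q - 1)`. -/
lemma integral_norm_sub_integral_rpow_le [CompleteSpace V] {Φ : (Fin n → ℝ) → V}
    (hΦ : ContDiff ℝ 1 Φ) (hg : PolyGrowth Φ) (hg' : PolyGrowth (fderiv ℝ Φ))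
    {q : ℝ} (hq : 2 ≤ q) :
    ∫ x, ‖Φ x - ∫ y, Φ y ∂(gaussianPi n)‖ ^ q ∂(gaussianPi n) ≤
      √(q - 1) ^ q * ∫ x, hsNorm (fderiv ℝ Φ x) ^ q ∂(gaussianPi n) := by
  have hq0 : 0 < q := by linarith
  set e := ∫ y, Φ y ∂(gaussianPi n) with he
  have hm : HasMoments (gaussianPi n) := hasMoments_of_isGaussian _
  have iΦ : Integrable Φ (gaussianPi n) := hm.integrable hg hΦ.continuous.aestronglyMeasurable
  have hf : fderiv ℝ (fun x => Φ x - e) = fderiv ℝ Φ := by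
    ext1 x; exact fderiv_sub_const e
  have h := integral_norm_rpow_le_of_integral_eq_zero (Φ := fun x => Φ x - e)
    (hΦ.sub contDiff_const) (hg.sub (polyGrowth_const e)) (by rwa [hf])
    (by rw [integral_sub iΦ (integrable_const _)]; simp [he]) hq
  rw [hf] at h
  set B := ∫ x, ‖Φ x - e‖ ^ q ∂(gaussianPi n)
  set A := ∫ x, hsNorm (fderiv ℝ Φ x) ^ q ∂(gaussianPi n)
  have hA : 0 ≤ A := integral_nonneg fun x => Real.rpow_nonneg (hsNorm_nonneg _) _
  have hB : 0 ≤ B := integral_nonneg fun x => Real.rpow_nonneg (norm_nonneg _) _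
  rcases hB.eq_or_lt with hB0 | hB0
  · rw [← hB0]; positivity
  -- divide by `B ^ (1 - 2 / q)`
  have h1 : B ^ (2 / q) ≤ (q - 1) * A ^ (2 / q) := by
    have e1 : B = B ^ (2 / q) * B ^ (1 - 2 / q) := by
      rw [← Real.rpow_add hB0, add_sub_cancel, Real.rpow_one]
    have hp : 0 < B ^ (1 - 2 / q) := Real.rpow_pos_of_pos hB0 _
    refine le_of_mul_le_mul_right ?_ hp
    rw [← e1, mul_assoc]
    exact h
  have h2 := Real.rpow_le_rpow (by positivity) h1 (by positivity : 0 ≤ q / 2)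
  have h3 : 2 / q * (q / 2) = 1 := by field_simp
  rw [Real.mul_rpow (by linarith) (by positivity), ← Real.rpow_mul hB, ← Real.rpow_mul hA, h3,
    Real.rpow_one, Real.rpow_one] at h2
  rwa [Real.sqrt_eq_rpow, ← Real.rpow_mul (by linarith), one_div_mul_eq_div]

end LargeExponent

/-! ### Both ranges of exponents together -/

section EuclideanSpace

variable {V : Type*} [NormedAddCommGroup V] [InnerProductSpace ℝ V] {n : ℕ}

/-- The Gaussian Poincaré inequality on `ℝⁿ`. -/
lemma eLpNorm_sub_integral_gaussianPi_le [CompleteSpace V] {Φ : (Fin n → ℝ) → V}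
    (hΦ : ContDiff ℝ 1 Φ) (hg : PolyGrowth Φ) (hg' : PolyGrowth (fderiv ℝ Φ))
    {q : ℝ} (hq : 1 ≤ q) :
    eLpNorm (fun x => Φ x - ∫ y, Φ y ∂(gaussianPi n)) (ENNReal.ofReal q) (gaussianPi n) ≤
      ENNReal.ofReal (poincareConst q) *
        eLpNorm (fun x => hsNorm (fderiv ℝ Φ x)) (ENNReal.ofReal q) (gaussianPi n) := by
  have hq0 : 0 < q := by linarith
  have hm : HasMoments (gaussianPi n) := hasMoments_of_isGaussian _
  have iΦ : Integrable Φ (gaussianPi n) := hm.integrable hg hΦ.continuous.aestronglyMeasurable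
  have hNc : Continuous fun x => hsNorm (fderiv ℝ Φ x) :=
    continuous_hsNorm.comp (hΦ.continuous_fderiv one_ne_zero)
  have hq1 : ENNReal.ofReal q ≠ 0 := by simpa using hq0
  unfold poincareConst
  split_ifs with hq2
  · rw [(hm.memLp (hg.sub (polyGrowth_const _)) (hΦ.continuous.sub
        continuous_const).aestronglyMeasurable hq0).eLpNorm_eq_integral_rpow_norm hq1 (by simp),
      (hm.memLp (polyGrowth_hsNorm_fderiv hg') hNc.aestronglyMeasurable
        hq0).eLpNorm_eq_integral_rpow_norm hq1 (by simp), ENNReal.toReal_ofReal hq0.le,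
      ← ENNReal.ofReal_mul (Real.sqrt_nonneg _)]
    simp_rw [Real.norm_of_nonneg (hsNorm_nonneg _)]
    refine ENNReal.ofReal_le_ofReal ?_
    refine (Real.rpow_le_rpow (integral_nonneg fun x => Real.rpow_nonneg (norm_nonneg _) _)
      (integral_norm_sub_integral_rpow_le hΦ hg hg' hq2) (by positivity)).trans_eq ?_
    rw [Real.mul_rpow (by positivity)
      (integral_nonneg fun x => Real.rpow_nonneg (hsNorm_nonneg _) _),
      ← Real.rpow_mul (Real.sqrt_nonneg _), mul_inv_cancel₀ hq0.ne', Real.rpow_one]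
  · rw [eLpNorm_eq_lintegral_rpow_enorm_toReal hq1 (by simp),
      eLpNorm_eq_lintegral_rpow_enorm_toReal hq1 (by simp), ENNReal.toReal_ofReal hq0.le]
    simp_rw [Real.enorm_of_nonneg (hsNorm_nonneg _)]
    refine (ENNReal.rpow_le_rpow (lintegral_enorm_sub_integral_rpow_le hΦ iΦ hq
      (not_le.1 hq2).le) (by positivity : 0 ≤ 1 / q)).trans_eq ?_
    rw [ENNReal.mul_rpow_of_nonneg _ _ (by positivity), ← ENNReal.rpow_mul,
      mul_one_div_cancel hq0.ne', ENNReal.rpow_one]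

lemma polyGrowth_of_hasTemperateGrowth {E F : Type*} [NormedAddCommGroup E] [NormedSpace ℝ E]
    [NormedAddCommGroup F] [NormedSpace ℝ F] {f : E → F} (hf : f.HasTemperateGrowth) :
    PolyGrowth f ∧ PolyGrowth (fderiv ℝ f) := by
  obtain ⟨k, C, h0⟩ := hf.2 0
  obtain ⟨l, D, h1⟩ := hf.2 1
  exact ⟨⟨C, k, fun x => by simpa using h0 x⟩, ⟨D, l, fun x => by simpa using h1 x⟩⟩

end EuclideanSpace

/-! ### Coordinates of an isonormal process -/

section Isonormal

variable {Ω H : Type*} [MeasurableSpace Ω] {P : Measure Ω} [NormedAddCommGroup H]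
  [InnerProductSpace ℝ H] {W : H → Ω → ℝ}

lemma IsIsonormal.memLp_two (hW : IsIsonormal W P) (h : H) : MemLp (W h) 2 P :=
  (hW.isGaussianProcess.hasGaussianLaw_eval h).memLp_two

lemma IsIsonormal.integrable_mul (hW : IsIsonormal W P) (g h : H) :
    Integrable (fun ω => W g ω * W h ω) P :=
  (hW.memLp_two g).integrable_mul (hW.memLp_two h)

/-- The isometry property of an isonormal process, for formal linear combinations. Linearity of
`W` in its index is not part of the definition; it follows from this identity. -/
lemma IsIsonormal.integral_sq_sum (hW : IsIsonormal W P) {ι : Type*} [Fintype ι]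
    (a : ι → ℝ) (g : ι → H) :
    ∫ ω, (∑ i, a i * W (g i) ω) ^ 2 ∂P = ‖∑ i, a i • g i‖ ^ 2 := by
  have e : ∀ ω, (∑ i, a i * W (g i) ω) ^ 2 =
      ∑ i, ∑ j, a i * a j * (W (g i) ω * W (g j) ω) := fun ω => by
    rw [pow_two, Finset.sum_mul_sum]
    refine Finset.sum_congr rfl fun i _ => Finset.sum_congr rfl fun j _ => by ring
  have hi : ∀ i j, Integrable (fun ω => a i * a j * (W (g i) ω * W (g j) ω)) P := fun i j =>
    (hW.integrable_mul _ _).const_mul _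
  simp_rw [e]
  rw [integral_finsetSum _ fun i _ => integrable_finsetSum _ fun j _ => hi i j,
    ← real_inner_self_eq_norm_sq, sum_inner]
  refine Finset.sum_congr rfl fun i _ => ?_
  rw [integral_finsetSum _ fun j _ => hi i j, inner_sum]
  refine Finset.sum_congr rfl fun j _ => ?_
  rw [integral_const_mul, hW.covariance, real_inner_smul_left, real_inner_smul_right]
  ring

/-- An isonormal process is almost surely linear along any given linear combination. -/
lemma IsIsonormal.ae_eq_sum (hW : IsIsonormal W P) {n : ℕ} {h : H} {a : Fin n → ℝ} {g : Fin n → H}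
    (hh : h = ∑ k, a k • g k) : ∀ᵐ ω ∂P, W h ω = ∑ k, a k * W (g k) ω := by
  -- the combination `-h + ∑ₖ aₖ gₖ = 0`, with index `none` for `h`
  have h2 := hW.integral_sq_sum (ι := Option (Fin n)) (fun o => o.elim (-1) a)
    (fun o => o.elim h g)
  simp only [Fintype.sum_option, Option.elim] at h2
  rw [neg_one_smul, ← hh, neg_add_cancel, norm_zero, zero_pow two_ne_zero] at h2
  have hL : MemLp (fun ω => -1 * W h ω + ∑ k, a k * W (g k) ω) 2 P :=
    ((hW.memLp_two h).const_mul _).add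
      (memLp_finsetSum _ fun k _ => (hW.memLp_two (g k)).const_mul _)
  rw [integral_eq_zero_iff_of_nonneg (fun ω => sq_nonneg _) hL.integrable_sq] at h2
  filter_upwards [h2] with ω hω
  have := pow_eq_zero_iff two_ne_zero |>.1 hω
  linarith

/-- The coordinates of an isonormal process along an orthonormal family are independent standard
Gaussian random variables. -/
lemma IsIsonormal.map_eq_gaussianPi (hW : IsIsonormal W P) {n : ℕ} {e : Fin n → H}
    (he : Orthonormal ℝ e) :
    AEMeasurable (fun ω k => W (e k) ω) P ∧ P.map (fun ω k => W (e k) ω) = gaussianPi n := by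
  have := hW.isGaussianProcess.isProbabilityMeasure
  have hlaw : HasGaussianLaw (fun ω k => W (e k) ω) P := by
    let L : ({k : Fin n // k ∈ Finset.univ} → ℝ) →L[ℝ] Fin n → ℝ :=
      ContinuousLinearMap.pi fun k => ContinuousLinearMap.proj ⟨k, Finset.mem_univ k⟩
    exact ((hW.isGaussianProcess.comp_right e).hasGaussianLaw Finset.univ).map L
  have hae : ∀ k, AEMeasurable (W (e k)) P := fun k => hW.isGaussianProcess.aemeasurable (e k)
  refine ⟨hlaw.aemeasurable, ?_⟩
  have hind : iIndepFun (fun k => W (e k)) P :=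
    hlaw.iIndepFun_of_covariance_eq_zero fun i j hij => by
      rw [covariance_eq_sub (hW.memLp_two _) (hW.memLp_two _)]
      simp only [Pi.mul_apply, hW.covariance, hW.centered, he.2 hij]
      simp
  rw [(iIndepFun_iff_map_fun_eq_pi_map hae).1 hind]
  congr 1; ext1 k
  rw [(hW.isGaussianProcess.hasGaussianLaw_eval (e k)).map_eq_gaussianReal, hW.centered,
    variance_of_integral_eq_zero (hae k) (hW.centered _)]
  have := hW.covariance (e k) (e k)
  rw [real_inner_self_eq_norm_sq, he.1 k] at this
  simp_rw [pow_two]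
  rw [this]
  simp

end Isonormal

/-! ### The Hilbert tensor product -/

section Tensor

variable {H V : Type*} [NormedAddCommGroup H] [InnerProductSpace ℝ H]
  [NormedAddCommGroup V] [InnerProductSpace ℝ V] {n : ℕ}

/-- The element `∑ₖ eₖ ⊗ A δₖ` of the Hilbert tensor product, with `δₖ` the standard basis of `ℝⁿ`. It
represents the linear map `A`
in the family `e`. -/
noncomputable def toHilbertTensor (e : Fin n → H) (A : (Fin n → ℝ) →L[ℝ] V) : HilbertTensor H V :=
  ((∑ k, e k ⊗ₜ[ℝ] A (Pi.single k 1) : H ⊗[ℝ] V) : HilbertTensor H V)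

lemma norm_toHilbertTensor {e : Fin n → H} (he : Orthonormal ℝ e) (A : (Fin n → ℝ) →L[ℝ] V) :
    ‖toHilbertTensor e A‖ = hsNorm A := by
  rw [toHilbertTensor, UniformSpace.Completion.norm_coe,
    ← sq_eq_sq₀ (norm_nonneg _) (hsNorm_nonneg A), ← real_inner_self_eq_norm_sq, sq_hsNorm,
    sum_inner]
  refine Finset.sum_congr rfl fun k _ => ?_
  rw [inner_sum]
  simp only [TensorProduct.inner_tmul, orthonormal_iff_ite.1 he]
  simp

lemma continuous_toHilbertTensor (e : Fin n → H) :
    Continuous (toHilbertTensor e : ((Fin n → ℝ) →L[ℝ] V) → HilbertTensor H V) := by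
  refine (UniformSpace.Completion.continuous_coe _).comp (continuous_finsetSum _ fun k _ => ?_)
  have h : Continuous fun w : V => e k ⊗ₜ[ℝ] w :=
    AddMonoidHomClass.continuous_of_bound (TensorProduct.mk ℝ H V (e k)) ‖e k‖ fun w =>
      (TensorProduct.norm_tmul (𝕜 := ℝ) (e k) w).le
  exact h.comp (by fun_prop)

end Tensor

/-! ### Reduction to finitely many coordinates -/

section Reduction

variable {Ω H V : Type*} [MeasurableSpace Ω] {P : Measure Ω} [NormedAddCommGroup H]
  [InnerProductSpace ℝ H] [NormedAddCommGroup V] [InnerProductSpace ℝ V] {W : H → Ω → ℝ}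

/-- A smooth random variable is a function `Φ` of finitely many coordinates of the isonormal
process along an orthonormal family, and its Malliavin derivative is the gradient of `Φ`. -/
lemma HasDeriv.exists_orthonormal (hW : IsIsonormal W P) {F : Ω → V}
    {DF : Ω → HilbertTensor H V} (hF : HasDeriv W P F DF) :
    ∃ (n : ℕ) (e : Fin n → H) (Φ : (Fin n → ℝ) → V), Orthonormal ℝ e ∧ Φ.HasTemperateGrowth ∧
      (∀ᵐ ω ∂P, F ω = Φ fun k => W (e k) ω) ∧
      (∀ᵐ ω ∂P, DF ω = toHilbertTensor e (fderiv ℝ Φ fun k => W (e k) ω)) := by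
  obtain ⟨J, G, DG, v, -, hG, hFeq, hDFeq⟩ := hF
  choose m h f _ hf hGeq hDGeq using hG
  let S : Submodule ℝ H := Submodule.span ℝ (Set.range fun p : (j : Fin J) × Fin (m j) => h p.1 p.2)
  have : FiniteDimensional ℝ S := FiniteDimensional.span_of_finite ℝ (Set.finite_range _)
  let b := stdOrthonormalBasis ℝ S
  let e : Fin (Module.finrank ℝ S) → H := fun k => b k
  have he : Orthonormal ℝ e := b.orthonormal.comp_linearIsometry S.subtypeₗᵢ
  let c : (j : Fin J) → Fin (m j) → Fin (Module.finrank ℝ S) → ℝ := fun j i k =>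
    inner ℝ (e k) (h j i)
  have hexp : ∀ j i, h j i = ∑ k, c j i k • e k := fun j i => by
    have hmem : h j i ∈ S := Submodule.subset_span ⟨⟨j, i⟩, rfl⟩
    have := congrArg (S.subtype) (b.sum_repr' ⟨h j i, hmem⟩)
    rw [map_sum] at this
    exact this.symm
  let A : (j : Fin J) → (Fin (Module.finrank ℝ S) → ℝ) →L[ℝ] (Fin (m j) → ℝ) := fun j =>
    ContinuousLinearMap.pi fun i => ∑ k, c j i k • ContinuousLinearMap.proj k
  have hA : ∀ j x i, A j x i = ∑ k, c j i k * x k := fun j x i => by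
    simp [A]
  let Φ : (Fin (Module.finrank ℝ S) → ℝ) → V := fun x => ∑ j, f j (A j x) • v j
  have hΦ : Φ.HasTemperateGrowth := Function.HasTemperateGrowth.sum fun j _ =>
    ((hf j).comp (A j).hasTemperateGrowth).smul (.const (v j))
  have hder : ∀ x k, fderiv ℝ Φ x (Pi.single k 1) =
      ∑ j, (∑ i, c j i k * fderiv ℝ (f j) (A j x) (Pi.single i 1)) • v j := fun x k => by
    have h1 : HasFDerivAt Φ (∑ j, ((fderiv ℝ (f j) (A j x)).comp (A j)).smulRight (v j)) x :=
      HasFDerivAt.fun_sum fun j _ =>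
        ((((hf j).1.differentiable (by simp)) _).hasFDerivAt.comp x (A j).hasFDerivAt).smul_const _
    rw [h1.fderiv, sum_apply]
    refine Finset.sum_congr rfl fun j _ => ?_
    rw [ContinuousLinearMap.smulRight_apply, ContinuousLinearMap.comp_apply,
      map_eq_sum_smul_single]
    simp [hA, Pi.single_apply]
  have hlin : ∀ᵐ ω ∂P, ∀ j i, W (h j i) ω = A j (fun k => W (e k) ω) i := by
    rw [ae_all_iff]; intro j
    rw [ae_all_iff]; intro i
    filter_upwards [hW.ae_eq_sum (hexp j i)] with ω hω
    rw [hω, hA]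
  refine ⟨_, e, Φ, he, hΦ, ?_, ?_⟩
  · filter_upwards [hFeq, hlin, ae_all_iff.2 hGeq] with ω h1 h2 h3
    rw [h1]
    refine Finset.sum_congr rfl fun j _ => ?_
    rw [h3 j]
    congr 2; ext i; exact h2 j i
  · filter_upwards [hDFeq, hlin, ae_all_iff.2 hDGeq] with ω h1 h2 h3
    have h4 : ∀ j, (fun k => W (h j k) ω) = A j fun k => W (e k) ω := fun j => by
      ext i; exact h2 j i
    have h5 : ∀ s : Fin J → H ⊗[ℝ] V, ∑ j, ((s j : H ⊗[ℝ] V) : HilbertTensor H V) =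
        ((∑ j, s j : H ⊗[ℝ] V) : HilbertTensor H V) := fun s =>
      (map_sum (UniformSpace.Completion.toComplₗᵢ (𝕜 := ℝ) (E := H ⊗[ℝ] V)) s Finset.univ).symm
    rw [h1, toHilbertTensor, h5]
    congr 1
    simp_rw [hder, h3, h4, TensorProduct.tmul_sum]
    rw [Finset.sum_comm]
    refine Finset.sum_congr rfl fun j _ => ?_
    simp_rw [TensorProduct.tmul_smul, TensorProduct.smul_tmul', ← TensorProduct.sum_tmul]
    congr 1
    simp_rw [Finset.sum_smul]
    rw [Finset.sum_comm]
    refine Finset.sum_congr rfl fun i _ => ?_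
    conv_lhs => rw [hexp j i, Finset.smul_sum]
    refine Finset.sum_congr rfl fun k _ => ?_
    rw [smul_smul, mul_comm]

end Reduction

end Malliavin

theorem theorem2p4
    {Ω : Type*} [MeasurableSpace Ω] (P : Measure Ω) [IsProbabilityMeasure P]
    {H : Type*} [NormedAddCommGroup H] [InnerProductSpace ℝ H] [CompleteSpace H]
    [TopologicalSpace.SeparableSpace H]
    {V : Type*} [NormedAddCommGroup V] [InnerProductSpace ℝ V] [CompleteSpace V]
    [TopologicalSpace.SeparableSpace V]
    (W : H → Ω → ℝ) (hW : Malliavin.IsIsonormal W P)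
    (q : ℝ) (hq : 1 ≤ q)
    (F : Ω → V) (DF : Ω → Malliavin.HilbertTensor H V) (hF : Malliavin.HasDeriv W P F DF) :
    MemLp F (ENNReal.ofReal q) P ∧ MemLp DF (ENNReal.ofReal q) P ∧
      eLpNorm (fun ω => F ω - ∫ ω', F ω' ∂P) (ENNReal.ofReal q) P ≤
        ENNReal.ofReal (Malliavin.poincareConst q) * eLpNorm DF (ENNReal.ofReal q) P := by
  have hq0 : 0 < q := by linarith
  obtain ⟨n, e, Φ, he, hΦ, hFeq, hDFeq⟩ := hF.exists_orthonormal hW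
  obtain ⟨hξ, hlaw⟩ := hW.map_eq_gaussianPi he
  set ξ : Ω → Fin n → ℝ := fun ω k => W (e k) ω with hξdef
  obtain ⟨hg, hg'⟩ := Malliavin.polyGrowth_of_hasTemperateGrowth hΦ
  have hC1 : ContDiff ℝ 1 Φ := hΦ.1.of_le (by exact_mod_cast le_top)
  have hm := Malliavin.hasMoments_of_isGaussian (Malliavin.gaussianPi n)
  have hcΦ := hC1.continuous
  have hcT : Continuous fun x => Malliavin.toHilbertTensor e (fderiv ℝ Φ x) :=
    (Malliavin.continuous_toHilbertTensor e).comp (hC1.continuous_fderiv one_ne_zero)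
  have hgT : Malliavin.PolyGrowth fun x => Malliavin.toHilbertTensor e (fderiv ℝ Φ x) :=
    (Malliavin.polyGrowth_hsNorm_fderiv hg').of_le fun x => by
      rw [Malliavin.norm_toHilbertTensor he, Real.norm_of_nonneg (Malliavin.hsNorm_nonneg _)]
  have hFΦ : F =ᵐ[P] Φ ∘ ξ := hFeq
  have hDFT : DF =ᵐ[P] (fun x => Malliavin.toHilbertTensor e (fderiv ℝ Φ x)) ∘ ξ := hDFeq
  have mΦ := hm.memLp hg hcΦ.aestronglyMeasurable hq0
  have mT := hm.memLp hgT hcT.aestronglyMeasurable hq0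
  refine ⟨?_, ?_, ?_⟩
  · rw [memLp_congr_ae hFΦ, ← memLp_map_measure_iff hcΦ.aestronglyMeasurable hξ, hlaw]
    exact mΦ
  · rw [memLp_congr_ae hDFT, ← memLp_map_measure_iff hcT.aestronglyMeasurable hξ, hlaw]
    exact mT
  · have hint : ∫ ω, F ω ∂P = ∫ x, Φ x ∂(Malliavin.gaussianPi n) := by
      rw [integral_congr_ae hFΦ, ← hlaw, integral_map hξ hcΦ.aestronglyMeasurable]
      rfl
    have h1 : (fun ω => F ω - ∫ ω', F ω' ∂P) =ᵐ[P]
        (fun x => Φ x - ∫ y, Φ y ∂(Malliavin.gaussianPi n)) ∘ ξ := by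
      filter_upwards [hFΦ] with ω hω
      rw [hint, hω]; rfl
    have h2 : eLpNorm (fun x => Malliavin.toHilbertTensor e (fderiv ℝ Φ x)) (ENNReal.ofReal q)
        (Malliavin.gaussianPi n) = eLpNorm (fun x => Malliavin.hsNorm (fderiv ℝ Φ x))
        (ENNReal.ofReal q) (Malliavin.gaussianPi n) :=
      eLpNorm_congr_norm_ae (ae_of_all _ fun x => by
        rw [Malliavin.norm_toHilbertTensor he, Real.norm_of_nonneg (Malliavin.hsNorm_nonneg _)])
    have hcs : Continuous fun x => Φ x - ∫ y, Φ y ∂(Malliavin.gaussianPi n) :=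
      hcΦ.sub continuous_const
    rw [eLpNorm_congr_ae h1, eLpNorm_congr_ae hDFT,
      ← eLpNorm_map_measure hcs.aestronglyMeasurable hξ,
      ← eLpNorm_map_measure hcT.aestronglyMeasurable hξ, hlaw, h2]
    exact Malliavin.eLpNorm_sub_integral_gaussianPi_le hC1 hg hg' hq
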